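/- **Setting.** Let $N\ge 2$, let $M\subseteq\mathbb R^N$ be open with a Riemannian metric $g$ of class $C^1$ (in particular $C^2$ or smooth is allowed), with Levi-Civita connection $\nabla$ and covariant derivative $\frac{D}{ds}$ along curves. Let $\phi:M\to\mathbb R$ be of class $C^2$, with Hessian $H^\phi(q)(v,w)=g(\nabla_v\nabla\phi,w)$, and put $\Omega=\phi^{-1}(]-\infty,0[)$, $\partial\Omega=\phi^{-1}(0)$, $\overline\Omega=\Omega\cup\partial\Omega$. Assume that $\nabla\phi\neq 0$ on $\partial\Omega$ and that $\overline\Omega$ is strongly concave, i.e. $H^\phi(q)(v,v)<0$ for all $q\in\partial\Omega$ and $0\ne v\in T_q\partial\Omega$. Let $\delta_0>0$ be such that for all $q$ with $\phi(q)\in[-\delta_0,\delta_0]$ one has $\nabla\phi(q)\ne 0$ and $H^\phi(q)(v,v)<0$ for every $v\neq 0$ with $g(\nabla\phi(q),v)=0$. Let $M_0\in\mathbb R$. Let $\mathfrak M_0$ be the set of $H^1$ curves $x:[0,1]\to\mathbb R^N$ (absolutely continuous with square integrable derivative) with values in $\phi^{-1}(]-\infty,\delta_0[)\subseteq M$ and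 $\phi(x(0))\ge0$, $\phi(x(1))\ge 0$. For $x\in\mathfrak M_0$ let $\mathcal I^0_x$ be the set of intervals $[a,b]\subseteq[0,1]$ with $x([a,b])\subseteq\overline\Omega$ and $x(a),x(b)\in\partial\Omega$, let $\mathcal I_x$ be the set of its elements that are maximal for inclusion, and let $\mathfrak M$ be the set of all $x\in\mathfrak M_0$ with $\frac12\int_a^b g(\dot x,\dot x)\,ds<M_0$ for all $[a,b]\in\mathcal I_x$. Let $\mathcal V^+(x)$ be the set of $V\in H^1([0,1],\mathbb R^N)$ with $g(V(s),\nabla\phi(x(s)))\ge 0$ for all $s\in[0,1]$ with $x(s)\in\partial\Omega$. The restriction $x|_{[a,b]}$ is a $\mathcal V^+$-variationally critical portion of $x$ if it is not constant and $$\int_a^b g\Big(\dot x,\frac{D}{ds}V\Big)\,ds\ge 0\qquad\text{for all } V\in\mathcal V^+(x).$$ A geodesic $\gamma:[a,b]\to M$, $a<b$, with $\gamma(a),\gamma(b)\in\partial\Omega$ and with lateral derivatives $\dot\gamma(a^+)$, $\dot\gamma(b^-)$ orthogonal to $T_{\gamma(a)}\partial\Omega$, $T_{\gamma(b)}\partial\Omega$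 is an orthogonal geodesic chord (OGC) if $\gamma(]a,b[)\subseteq\Omega$; it is a weak orthogonal geodesic chord (WOGC) if it is not constant, has image in $\overline\Omega$, and $\gamma(s_0)\in\partial\Omega$ for some $s_0\in]a,b[$. **Statement.** Let $x\in\mathfrak M$ and $[a,b]\in\mathcal I^0_x$ be such that $x|_{[a,b]}$ is a $\mathcal V^+$-variationally critical portion of $x$. Then: 1. if $[\alpha,\beta]\subseteq[a,b]$, $\alpha<\beta$, and $x(]\alpha,\beta[)\subseteq\Omega$, then $x|_{[\alpha,\beta]}$ is a geodesic; 2. $x^{-1}(\partial\Omega)\cap[a,b]$ is a finite disjoint union of closed intervals, possibly reduced to points; 3. $x$ is constant on each connected component of $x^{-1}(\partial\Omega)\cap[a,b]$; 4. $x|_{[a,b]}$ is piecewise $C^2$, with break points only at parameters $t$ with $x(t)\in\partial\Omega$: there is a finite set $T\subseteq x^{-1}(\partial\Omega)\cap[a,b]$ such that $x$ is of class $C^2$ on each $[\alpha,\beta]\subseteq[a,b]$, $\alpha<\beta$, with $T\cap]\alpha,\beta[=\emptyset$; 5. for each $[\alpha,\beta]\subseteq[a,b]$, $\alpha<\beta$,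 on which $x$ is of class $C^2$, $x|_{[\alpha,\beta]}$ is a geodesic in $\overline\Omega$; 6. $\inf\{\phi(x(s)) : s\in[a,b]\}<-\delta_0$; 7. if moreover there is no WOGC in $\overline\Omega$ and $x|_{[a,b]}$ is of class $C^1$, then $x|_{[a,b]}$ is an orthogonal geodesic chord in $\overline\Omega$; in particular $x(]a,b[)\subseteq\Omega$. -/

import Mathlib

open Set MeasureTheory

noncomputable section

/-- A Riemannian metric of class `C¹` on a set `U` (an open set, in all uses) of `ℝᴺ`,
given by its values `g q : ℝᴺ × ℝᴺ → ℝ`, `q ∈ U`. -/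
structure RiemMetricOn {N : ℕ} (U : Set (EuclideanSpace ℝ (Fin N))) where
  toFun : EuclideanSpace ℝ (Fin N) →
    EuclideanSpace ℝ (Fin N) →L[ℝ] EuclideanSpace ℝ (Fin N) →L[ℝ] ℝ
  symm : ∀ q ∈ U, ∀ v w, toFun q v w = toFun q w v
  pos : ∀ q ∈ U, ∀ v, v ≠ 0 → 0 < toFun q v v
  contDiffOn : ContDiffOn ℝ 1 toFun U

namespace RiemMetricOn

variable {N : ℕ} {U : Set (EuclideanSpace ℝ (Fin N))}

/-- The musical isomorphism: `g.sharp q ℓ` is the vector with `g_q(g.sharp q ℓ, ·) = ℓ`, `q ∈ U`. -/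
def sharp (g : RiemMetricOn U) (q : EuclideanSpace ℝ (Fin N)) :
    (EuclideanSpace ℝ (Fin N) →L[ℝ] ℝ) →L[ℝ] EuclideanSpace ℝ (Fin N) :=
  (g.toFun q).inverse

/-- The Christoffel symbols of the Levi-Civita connection:
`g(Γ(v,w), u) = ½ (∂_v g(w,u) + ∂_w g(v,u) - ∂_u g(v,w))`. -/
def christoffel (g : RiemMetricOn U) (q v w : EuclideanSpace ℝ (Fin N)) :
    EuclideanSpace ℝ (Fin N) :=
  g.sharp q ((1 / 2 : ℝ) • (fderiv ℝ g.toFun q v w + fderiv ℝ g.toFun q w v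
    - ((fderiv ℝ g.toFun q).flip v).flip w))

/-- The Levi-Civita covariant derivative `∇_v X` at `q` of a vector field `X`. -/
def covDeriv (g : RiemMetricOn U) (X : EuclideanSpace ℝ (Fin N) → EuclideanSpace ℝ (Fin N))
    (q v : EuclideanSpace ℝ (Fin N)) : EuclideanSpace ℝ (Fin N) :=
  fderiv ℝ X q v + g.christoffel q v (X q)

/-- The covariant derivative `DV/ds` of a vector field `V` along a curve `x`, where the derivatives
with respect to the parameter are taken within `S` (one-sided at an endpoint of an interval `S`). -/
def covDerivAlong (g : RiemMetricOn U) (S : Set ℝ) (x V : ℝ → EuclideanSpace ℝ (Fin N))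
    (s : ℝ) : EuclideanSpace ℝ (Fin N) :=
  derivWithin V S s + g.christoffel (x s) (derivWithin x S s) (V s)

/-- The gradient `∇φ`. -/
def grad (g : RiemMetricOn U) (φ : EuclideanSpace ℝ (Fin N) → ℝ)
    (q : EuclideanSpace ℝ (Fin N)) : EuclideanSpace ℝ (Fin N) :=
  g.sharp q (fderiv ℝ φ q)

/-- The Hessian `H^φ(q)(v,w) = g(∇_v ∇φ, w)`. -/
def hess (g : RiemMetricOn U) (φ : EuclideanSpace ℝ (Fin N) → ℝ)
    (q v w : EuclideanSpace ℝ (Fin N)) : ℝ :=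
  g.toFun q (g.covDeriv (g.grad φ) q v) w

/-- `γ` restricted to `[a,b]`, `a < b`, is an (affinely parametrized, possibly constant) geodesic of
`(U, g)`: it is of class `C²` up to the endpoints and `D γ'/ds = 0`. -/
def IsGeodesicOn (g : RiemMetricOn U) (γ : ℝ → EuclideanSpace ℝ (Fin N)) (a b : ℝ) : Prop :=
  a < b ∧ (∀ s ∈ Icc a b, γ s ∈ U) ∧ ContDiffOn ℝ 2 γ (Icc a b) ∧
    ∀ s ∈ Icc a b, g.covDerivAlong (Icc a b) γ (derivWithin γ (Icc a b)) s = 0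

/-- The energy `f_{a,b}(x) = ½ ∫_a^b g(x', x') ds`. -/
def energy (g : RiemMetricOn U) (x : ℝ → EuclideanSpace ℝ (Fin N)) (a b : ℝ) : ℝ :=
  (1 / 2 : ℝ) * ∫ s in a..b,
    g.toFun (x s) (derivWithin x (Icc a b) s) (derivWithin x (Icc a b) s)

end RiemMetricOn

/-- `Ω = {φ < 0}`. -/
def domainOf {N : ℕ} (U : Set (EuclideanSpace ℝ (Fin N)))
    (φ : EuclideanSpace ℝ (Fin N) → ℝ) : Set (EuclideanSpace ℝ (Fin N)) :=
  {q ∈ U | φ q < 0}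

/-- `∂Ω = {φ = 0}` (the boundary relative to `U`, when `dφ ≠ 0` on this set). -/
def boundaryOf {N : ℕ} (U : Set (EuclideanSpace ℝ (Fin N)))
    (φ : EuclideanSpace ℝ (Fin N) → ℝ) : Set (EuclideanSpace ℝ (Fin N)) :=
  {q ∈ U | φ q = 0}

/-- The closure of `Ω`, that is `Ω ∪ ∂Ω`. -/
def closureOf {N : ℕ} (U : Set (EuclideanSpace ℝ (Fin N)))
    (φ : EuclideanSpace ℝ (Fin N) → ℝ) : Set (EuclideanSpace ℝ (Fin N)) :=
  domainOf U φ ∪ boundaryOf U φ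

/-- Strong concavity: the Hessian of `φ` is negative definite on `T_q ∂Ω = ker dφ_q`, `q ∈ ∂Ω`. -/
def StronglyConcave {N : ℕ} {U : Set (EuclideanSpace ℝ (Fin N))} (g : RiemMetricOn U)
    (φ : EuclideanSpace ℝ (Fin N) → ℝ) : Prop :=
  ∀ q ∈ boundaryOf U φ, ∀ v, v ≠ 0 → fderiv ℝ φ q v = 0 → g.hess φ q v v < 0

/-- `δ₀ > 0`, and on the strip `φ⁻¹([-δ₀, δ₀])` one has `∇φ ≠ 0` and the Hessian of `φ` is negative
definite on the orthogonal complement `ker dφ_q` of the gradient. -/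
def IsConcavityWidth {N : ℕ} {U : Set (EuclideanSpace ℝ (Fin N))} (g : RiemMetricOn U)
    (φ : EuclideanSpace ℝ (Fin N) → ℝ) (δ₀ : ℝ) : Prop :=
  0 < δ₀ ∧ ∀ q ∈ U, φ q ∈ Icc (-δ₀) δ₀ → g.grad φ q ≠ 0 ∧
    ∀ v, v ≠ 0 → g.toFun q (g.grad φ q) v = 0 → g.hess φ q v v < 0

/-- The Sobolev space `H¹([a,b], ℝᴺ)`: absolutely continuous curves with square integrable
derivative. -/
def IsH1 {N : ℕ} (a b : ℝ) (x : ℝ → EuclideanSpace ℝ (Fin N)) : Prop :=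
  AbsolutelyContinuousOnInterval x a b ∧ MemLp (deriv x) 2 (volume.restrict (Icc a b))

/-- The collection `𝓘⁰_x` of the intervals `[a,b] ⊆ [0,1]` with `x([a,b])` contained in the closure
of `Ω` and `x(a), x(b) ∈ ∂Ω`. -/
def intervals0 {N : ℕ} (U : Set (EuclideanSpace ℝ (Fin N)))
    (φ : EuclideanSpace ℝ (Fin N) → ℝ) (x : ℝ → EuclideanSpace ℝ (Fin N)) : Set (ℝ × ℝ) :=
  {p | 0 ≤ p.1 ∧ p.1 ≤ p.2 ∧ p.2 ≤ 1 ∧ (∀ s ∈ Icc p.1 p.2, x s ∈ closureOf U φ) ∧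
    x p.1 ∈ boundaryOf U φ ∧ x p.2 ∈ boundaryOf U φ}

/-- The collection `𝓘_x` of the intervals in `𝓘⁰_x` that are maximal for inclusion. -/
def maximalIntervals {N : ℕ} (U : Set (EuclideanSpace ℝ (Fin N)))
    (φ : EuclideanSpace ℝ (Fin N) → ℝ) (x : ℝ → EuclideanSpace ℝ (Fin N)) : Set (ℝ × ℝ) :=
  {p | p ∈ intervals0 U φ x ∧
    ∀ r ∈ intervals0 U φ x, Icc p.1 p.2 ⊆ Icc r.1 r.2 → r = p}

/-- The path space `𝔐₀`: the `H¹` curves `[0,1] → φ⁻¹(]-∞, δ₀[)` with `φ(x(0)), φ(x(1)) ≥ 0`. -/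
def pathSpace0 {N : ℕ} (U : Set (EuclideanSpace ℝ (Fin N)))
    (φ : EuclideanSpace ℝ (Fin N) → ℝ) (δ₀ : ℝ) : Set (ℝ → EuclideanSpace ℝ (Fin N)) :=
  {x | IsH1 0 1 x ∧ (∀ s ∈ Icc (0 : ℝ) 1, x s ∈ U ∧ φ (x s) < δ₀) ∧ 0 ≤ φ (x 0) ∧ 0 ≤ φ (x 1)}

/-- The path space `𝔐`: the curves of `𝔐₀` whose energy is less than `M₀` on each maximal
interval. -/
def pathSpace {N : ℕ} {U : Set (EuclideanSpace ℝ (Fin N))} (g : RiemMetricOn U)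
    (φ : EuclideanSpace ℝ (Fin N) → ℝ) (δ₀ M₀ : ℝ) : Set (ℝ → EuclideanSpace ℝ (Fin N)) :=
  {x | x ∈ pathSpace0 U φ δ₀ ∧ ∀ p ∈ maximalIntervals U φ x, g.energy x p.1 p.2 < M₀}

/-- The cone `𝓥⁺(x)` of the `H¹` fields along `x` (on `[0,1]`) pointing outwards from `Ω` wherever
`x` is on `∂Ω`. -/
def outwardCone {N : ℕ} {U : Set (EuclideanSpace ℝ (Fin N))} (g : RiemMetricOn U)
    (φ : EuclideanSpace ℝ (Fin N) → ℝ) (x : ℝ → EuclideanSpace ℝ (Fin N)) :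
    Set (ℝ → EuclideanSpace ℝ (Fin N)) :=
  {V | IsH1 0 1 V ∧ ∀ s ∈ Icc (0 : ℝ) 1, x s ∈ boundaryOf U φ →
    0 ≤ g.toFun (x s) (V s) (g.grad φ (x s))}

/-- `x` restricted to `[a,b]` is a `𝓥⁺`-variationally critical portion of `x`. -/
def IsVarCriticalPortion {N : ℕ} {U : Set (EuclideanSpace ℝ (Fin N))} (g : RiemMetricOn U)
    (φ : EuclideanSpace ℝ (Fin N) → ℝ) (x : ℝ → EuclideanSpace ℝ (Fin N)) (a b : ℝ) : Prop :=
  (∃ s ∈ Icc a b, ∃ t ∈ Icc a b, x s ≠ x t) ∧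
    ∀ V ∈ outwardCone g φ x, 0 ≤ ∫ s in a..b,
      g.toFun (x s) (derivWithin x (Icc a b) s) (g.covDerivAlong (Icc a b) x V s)

/-- The lateral velocities of `γ` at `a` and `b` are `g`-orthogonal to `T ∂Ω = ker dφ`. -/
def OrthogonalEnds {N : ℕ} {U : Set (EuclideanSpace ℝ (Fin N))} (g : RiemMetricOn U)
    (φ : EuclideanSpace ℝ (Fin N) → ℝ) (γ : ℝ → EuclideanSpace ℝ (Fin N)) (a b : ℝ) : Prop :=
  (∀ v, fderiv ℝ φ (γ a) v = 0 → g.toFun (γ a) (derivWithin γ (Icc a b) a) v = 0) ∧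
    ∀ v, fderiv ℝ φ (γ b) v = 0 → g.toFun (γ b) (derivWithin γ (Icc a b) b) v = 0

/-- Orthogonal geodesic chord (OGC). -/
def IsOGC {N : ℕ} {U : Set (EuclideanSpace ℝ (Fin N))} (g : RiemMetricOn U)
    (φ : EuclideanSpace ℝ (Fin N) → ℝ) (γ : ℝ → EuclideanSpace ℝ (Fin N)) (a b : ℝ) : Prop :=
  g.IsGeodesicOn γ a b ∧ (∀ s ∈ Ioo a b, γ s ∈ domainOf U φ) ∧
    γ a ∈ boundaryOf U φ ∧ γ b ∈ boundaryOf U φ ∧ OrthogonalEnds g φ γ a b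

/-- Weak orthogonal geodesic chord (WOGC). Constant curves are not counted: otherwise each boundary
point would be one. -/
def IsWOGC {N : ℕ} {U : Set (EuclideanSpace ℝ (Fin N))} (g : RiemMetricOn U)
    (φ : EuclideanSpace ℝ (Fin N) → ℝ) (γ : ℝ → EuclideanSpace ℝ (Fin N)) (a b : ℝ) : Prop :=
  g.IsGeodesicOn γ a b ∧ (∃ s ∈ Icc a b, ∃ t ∈ Icc a b, γ s ≠ γ t) ∧
    (∀ s ∈ Icc a b, γ s ∈ closureOf U φ) ∧
    γ a ∈ boundaryOf U φ ∧ γ b ∈ boundaryOf U φ ∧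
    (∃ s₀ ∈ Ioo a b, γ s₀ ∈ boundaryOf U φ) ∧ OrthogonalEnds g φ γ a b

/-- The set `x⁻¹(∂Ω) ∩ [a,b]`. -/
def contactSet {N : ℕ} (U : Set (EuclideanSpace ℝ (Fin N)))
    (φ : EuclideanSpace ℝ (Fin N) → ℝ) (x : ℝ → EuclideanSpace ℝ (Fin N)) (a b : ℝ) : Set ℝ :=
  {s ∈ Icc a b | x s ∈ boundaryOf U φ}

end

open scoped Topology

set_option maxSynthPendingDepth 3

/-! The first variation of the energy in direction `V` is the integral of `g(x', V') + ½ (∂_V g)(x',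
x')`. Criticality says that it is nonnegative for `V` in the cone, and each conclusion comes from a
good choice of `V`.

Where `x` runs inside `Ω` the cone imposes no condition, so `V` and `-V` are both admissible and the
variation vanishes. The du Bois-Reymond lemma then identifies the momentum `g(x', ·)` a.e. with a
primitive of an integrable force, and a bootstrap gives the geodesic equation up to the ends of the
interval (`isGeodesicOn_of_mem_domain`). Where `x` stays on `∂Ω`, take `V = ψ ∇φ` with a cutoff `ψ ≥
0`: since `x'` is tangent to `∂Ω`, the variation is the integral of `ψ H^φ(x', x')`, which is
nonpositive by concavity, hence zero, and `x' = 0` a.e. (`eq_of_forall_mem_boundary`).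

Finiteness is quantitative. A geodesic in `Ω` with both ends on `∂Ω` must dip below `-δ₀`: at an
interior minimum of `φ` inside the strip its velocity would be tangent to the level set, where the
Hessian is negative (`exists_lt_neg_width`). By uniform continuity of `φ ∘ x`, every gap of the
contact set has length at least some fixed `η > 0`, so there are finitely many gaps. Since `x` is
not constant, there is at least one, which bounds the infimum of `φ`.

If `x` is `C¹`, its velocity satisfies the geodesic equation across the finitely many break points.
The first variation is then a difference of boundary terms. Fields of the cone concentrated at one
endpoint take there every value of an open half-space, and this forces orthogonality. An interior
contact would therefore produce a WOGC. -/

/-- The coordinate space `ℝᴺ`. -/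
abbrev Euc (N : ℕ) : Type := EuclideanSpace ℝ (Fin N)

/-! ### Pointwise algebra and regularity of the metric -/

namespace RiemMetricOn

variable {N : ℕ} {U : Set (Euc N)}

/-- Positivity gives injectivity, and a space and its dual have the same finite dimension. This
keeps `sharp` from being the default value `0` of `inverse`. -/
theorem isInvertible (g : RiemMetricOn U) {q : Euc N} (hq : q ∈ U) :
    (g.toFun q).IsInvertible := by
  have hinj : Function.Injective (g.toFun q) := by
    rw [injective_iff_map_eq_zero]
    intro v hv
    by_contra hne
    have := g.pos q hq v hne
    rw [hv] at this
    simp at this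
  have hfin : Module.finrank ℝ (Euc N) = Module.finrank ℝ (Euc N →L[ℝ] ℝ) :=
    (InnerProductSpace.toDual ℝ (Euc N)).toLinearEquiv.finrank_eq
  let e : Euc N ≃ₗ[ℝ] (Euc N →L[ℝ] ℝ) :=
    LinearEquiv.ofInjectiveOfFinrankEq (g.toFun q : Euc N →ₗ[ℝ] (Euc N →L[ℝ] ℝ)) hinj hfin
  refine ⟨e.toContinuousLinearEquiv, ?_⟩
  ext v
  rfl

theorem toFun_sharp (g : RiemMetricOn U) {q : Euc N} (hq : q ∈ U) (l : Euc N →L[ℝ] ℝ) :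
    g.toFun q (g.sharp q l) = l := by
  obtain ⟨e, he⟩ := g.isInvertible hq
  rw [sharp, ← he, ContinuousLinearMap.inverse_equiv]
  simp

theorem sharp_toFun (g : RiemMetricOn U) {q : Euc N} (hq : q ∈ U) (v : Euc N) :
    g.sharp q (g.toFun q v) = v := by
  obtain ⟨e, he⟩ := g.isInvertible hq
  rw [sharp, ← he, ContinuousLinearMap.inverse_equiv]
  simp

/-- Operator inversion is smooth near an invertible operator, so `sharp` inherits the regularity of
the metric. -/
theorem contDiffOn_sharp (g : RiemMetricOn U) : ContDiffOn ℝ 1 g.sharp U := by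
  intro q hq
  have h := (g.isInvertible hq).contDiffAt_map_inverse (n := 1)
  exact h.comp_contDiffWithinAt q (g.contDiffOn q hq)

theorem contDiffOn_grad (g : RiemMetricOn U) (hU : IsOpen U) {φ : Euc N → ℝ}
    (hφ : ContDiffOn ℝ 2 φ U) : ContDiffOn ℝ 1 (g.grad φ) U :=
  g.contDiffOn_sharp.clm_apply (hφ.fderiv_of_isOpen hU (by norm_num))

theorem toFun_grad (g : RiemMetricOn U) (φ : Euc N → ℝ) {q : Euc N} (hq : q ∈ U) :
    g.toFun q (g.grad φ q) = fderiv ℝ φ q :=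
  g.toFun_sharp hq _

theorem toFun_grad_right (g : RiemMetricOn U) (φ : Euc N → ℝ) {q : Euc N} (hq : q ∈ U)
    (v : Euc N) : g.toFun q v (g.grad φ q) = fderiv ℝ φ q v := by
  rw [g.symm q hq, g.toFun_grad φ hq]

theorem differentiableAt (g : RiemMetricOn U) (hU : IsOpen U) {q : Euc N} (hq : q ∈ U) :
    DifferentiableAt ℝ g.toFun q :=
  (g.contDiffOn.differentiableOn (by norm_num)).differentiableAt (hU.mem_nhds hq)

theorem continuousOn_fderiv (g : RiemMetricOn U) (hU : IsOpen U) :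
    ContinuousOn (fderiv ℝ g.toFun) U :=
  g.contDiffOn.continuousOn_fderiv_of_isOpen hU (by norm_num)

theorem fderiv_symm (g : RiemMetricOn U) (hU : IsOpen U) {q : Euc N} (hq : q ∈ U)
    (u v w : Euc N) : fderiv ℝ g.toFun q u v w = fderiv ℝ g.toFun q u w v := by
  have h := (g.differentiableAt hU hq).hasFDerivAt
  have h1 := (h.clm_apply (hasFDerivAt_const v q)).clm_apply (hasFDerivAt_const w q)
  have h2 := (h.clm_apply (hasFDerivAt_const w q)).clm_apply (hasFDerivAt_const v q)
  have h3 := h1.congr_of_eventuallyEq (f₁ := fun y => g.toFun y w v)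
    (Filter.eventually_of_mem (hU.mem_nhds hq) fun y hy => g.symm y hy w v)
  have := h3.unique h2
  simpa using congrArg (fun L => L u) this

theorem toFun_christoffel (g : RiemMetricOn U) {q : Euc N} (hq : q ∈ U) (v w u : Euc N) :
    g.toFun q (g.christoffel q v w) u = 1 / 2 * (fderiv ℝ g.toFun q v w u
      + fderiv ℝ g.toFun q w v u - fderiv ℝ g.toFun q u v w) := by
  rw [christoffel, g.toFun_sharp hq]
  simp

/-- `g(v, Γ(v,w)) = ½ (∂_w g)(v,v)`. -/
theorem toFun_christoffel_right (g : RiemMetricOn U) (hU : IsOpen U) {q : Euc N} (hq : q ∈ U)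
    (v w : Euc N) :
    g.toFun q v (g.christoffel q v w) = 1 / 2 * fderiv ℝ g.toFun q w v v := by
  rw [g.symm q hq, g.toFun_christoffel hq, g.fderiv_symm hU hq v w v]
  ring

/-- On the diagonal the Christoffel term collapses to a derivative of the metric. The resulting
expression appears both in the second derivative of `φ` along a geodesic and in the first variation
in direction `∇φ`. -/
theorem hess_self (g : RiemMetricOn U) (hU : IsOpen U) (φ : Euc N → ℝ) {q : Euc N} (hq : q ∈ U)
    (v : Euc N) : g.hess φ q v v = g.toFun q v (fderiv ℝ (g.grad φ) q v)
      + 1 / 2 * fderiv ℝ g.toFun q (g.grad φ q) v v := by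
  rw [hess, covDeriv, map_add, add_apply,
    g.symm q hq (g.christoffel q v _), g.toFun_christoffel_right hU hq, g.symm q hq _ v]

theorem christoffel_zero_left (g : RiemMetricOn U) (q w : Euc N) : g.christoffel q 0 w = 0 := by
  simp [christoffel]

/-- The momentum form `½ (∂_· g)(v,v)` of the geodesic equation. -/
noncomputable def force (g : RiemMetricOn U) (q v : Euc N) : Euc N →L[ℝ] ℝ :=
  (1 / 2 : ℝ) • (((fderiv ℝ g.toFun q).flip v).flip v)

theorem force_apply (g : RiemMetricOn U) (q v w : Euc N) :
    g.force q v w = 1 / 2 * fderiv ℝ g.toFun q w v v := by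
  simp [force]

/-- Covariant and momentum formulations of the geodesic equation are equivalent. -/
theorem geodesic_eq_iff (g : RiemMetricOn U) {q : Euc N} (hq : q ∈ U)
    (v c : Euc N) : c + g.christoffel q v v = 0 ↔
      fderiv ℝ g.toFun q v v + g.toFun q c = g.force q v := by
  -- Lowering the index of the covariant acceleration gives exactly momentum derivative minus force.
  have key : ∀ u, g.toFun q (c + g.christoffel q v v) u
      = (fderiv ℝ g.toFun q v v + g.toFun q c - g.force q v) u := by
    intro u
    simp only [map_add, add_apply, sub_apply, force_apply,
      g.toFun_christoffel hq]
    ring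
  constructor
  · intro h
    rw [← sub_eq_zero]
    ext u
    rw [← key, h]
    simp
  · intro h
    rw [← g.sharp_toFun hq (c + g.christoffel q v v)]
    have : g.toFun q (c + g.christoffel q v v) = 0 := by
      ext u
      rw [key, h]
      simp
    rw [this, map_zero]

theorem continuousOn_christoffel_comp (g : RiemMetricOn U) (hU : IsOpen U) {S : Set ℝ}
    {x v w : ℝ → Euc N} (hx : ContinuousOn x S) (hxU : MapsTo x S U) (hv : ContinuousOn v S)
    (hw : ContinuousOn w S) : ContinuousOn (fun s => g.christoffel (x s) (v s) (w s)) S := by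
  have h1 : ContinuousOn (fun s => fderiv ℝ g.toFun (x s)) S :=
    (g.continuousOn_fderiv hU).comp hx hxU
  have h2 : ContinuousOn (fun s => g.sharp (x s)) S :=
    g.contDiffOn_sharp.continuousOn.comp hx hxU
  have h3 : ContinuousOn (fun s => (fderiv ℝ g.toFun (x s)).flip) S :=
    (ContinuousLinearMap.flipₗᵢ ℝ (Euc N) (Euc N) (Euc N →L[ℝ] ℝ)).continuous.comp_continuousOn h1
  have h4 : ContinuousOn (fun s => ((fderiv ℝ g.toFun (x s)).flip (v s)).flip) S :=
    (ContinuousLinearMap.flipₗᵢ ℝ (Euc N) (Euc N) ℝ).continuous.comp_continuousOn (h3.clm_apply hv)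
  have h5 := ((((h1.clm_apply hv).clm_apply hw).add ((h1.clm_apply hw).clm_apply hv)).sub
    (h4.clm_apply hw)).const_smul (1 / 2 : ℝ)
  exact h2.clm_apply h5

theorem continuousOn_force_comp (g : RiemMetricOn U) (hU : IsOpen U) {S : Set ℝ}
    {x v : ℝ → Euc N} (hx : ContinuousOn x S) (hxU : MapsTo x S U) (hv : ContinuousOn v S) :
    ContinuousOn (fun s => g.force (x s) (v s)) S := by
  have h1 : ContinuousOn (fun s => fderiv ℝ g.toFun (x s)) S :=
    (g.continuousOn_fderiv hU).comp hx hxU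
  have h3 : ContinuousOn (fun s => (fderiv ℝ g.toFun (x s)).flip) S :=
    (ContinuousLinearMap.flipₗᵢ ℝ (Euc N) (Euc N) (Euc N →L[ℝ] ℝ)).continuous.comp_continuousOn h1
  have h4 : ContinuousOn (fun s => ((fderiv ℝ g.toFun (x s)).flip (v s)).flip) S :=
    (ContinuousLinearMap.flipₗᵢ ℝ (Euc N) (Euc N) ℝ).continuous.comp_continuousOn (h3.clm_apply hv)
  have h5 := (h4.clm_apply hv).const_smul (1 / 2 : ℝ)
  exact h5

end RiemMetricOn

/-! ### Geodesics: conservation of speed and behaviour of `φ` along them -/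

namespace RiemMetricOn

variable {N : ℕ} {U : Set (Euc N)}

/-- Along a curve with acceleration `c`, the derivative of the momentum `g(v, ·)`. -/
theorem hasDerivWithinAt_momentum (g : RiemMetricOn U) (hU : IsOpen U) {S : Set ℝ} {s : ℝ}
    {x v : ℝ → Euc N} {c : Euc N} (hxU : x s ∈ U) (hx : HasDerivWithinAt x (v s) S s)
    (hv : HasDerivWithinAt v c S s) :
    HasDerivWithinAt (fun t => g.toFun (x t) (v t))
      (fderiv ℝ g.toFun (x s) (v s) (v s) + g.toFun (x s) c) S s := by
  have h1 := (g.differentiableAt hU hxU).hasFDerivAt.comp_hasDerivWithinAt s hx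
  exact h1.clm_apply hv

namespace IsGeodesicOn

variable {g : RiemMetricOn U} {x : ℝ → Euc N} {α β : ℝ}

theorem hasDerivWithinAt (h : g.IsGeodesicOn x α β) {s : ℝ} (hs : s ∈ Icc α β) :
    HasDerivWithinAt x (derivWithin x (Icc α β) s) (Icc α β) s :=
  ((h.2.2.1.differentiableOn (by norm_num)) s hs).hasDerivWithinAt

theorem contDiffOn_velocity (h : g.IsGeodesicOn x α β) :
    ContDiffOn ℝ 1 (derivWithin x (Icc α β)) (Icc α β) :=
  h.2.2.1.derivWithin (uniqueDiffOn_Icc h.1) (by norm_num)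

theorem hasDerivWithinAt_velocity (h : g.IsGeodesicOn x α β) {s : ℝ} (hs : s ∈ Icc α β) :
    HasDerivWithinAt (derivWithin x (Icc α β))
      (-g.christoffel (x s) (derivWithin x (Icc α β) s) (derivWithin x (Icc α β) s))
      (Icc α β) s := by
  have h1 := ((h.contDiffOn_velocity.differentiableOn (by norm_num)) s hs).hasDerivWithinAt
  have h2 := h.2.2.2 s hs
  rw [covDerivAlong] at h2
  rwa [eq_neg_of_add_eq_zero_left h2] at h1

theorem hasDerivWithinAt_momentum (h : g.IsGeodesicOn x α β) (hU : IsOpen U) {s : ℝ}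
    (hs : s ∈ Icc α β) :
    HasDerivWithinAt (fun t => g.toFun (x t) (derivWithin x (Icc α β) t))
      (g.force (x s) (derivWithin x (Icc α β) s)) (Icc α β) s := by
  have h1 := g.hasDerivWithinAt_momentum hU (h.2.1 s hs) (h.hasDerivWithinAt hs)
    (h.hasDerivWithinAt_velocity hs)
  rwa [(g.geodesic_eq_iff (h.2.1 s hs) _ _).1 (neg_add_cancel _)] at h1

/-- The speed of a geodesic is constant. -/
theorem speed_eq (h : g.IsGeodesicOn x α β) (hU : IsOpen U) {s : ℝ} (hs : s ∈ Icc α β) :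
    g.toFun (x s) (derivWithin x (Icc α β) s) (derivWithin x (Icc α β) s) =
      g.toFun (x α) (derivWithin x (Icc α β) α) (derivWithin x (Icc α β) α) := by
  have hd : ∀ t ∈ Icc α β, HasDerivWithinAt
      (fun t => g.toFun (x t) (derivWithin x (Icc α β) t) (derivWithin x (Icc α β) t)) 0
      (Icc α β) t := by
    intro t ht
    have h1 := (h.hasDerivWithinAt_momentum hU ht).clm_apply (h.hasDerivWithinAt_velocity ht)
    refine h1.congr_deriv ?_
    rw [map_neg, g.toFun_christoffel_right hU (h.2.1 t ht), force_apply]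
    ring
  exact constant_of_derivWithin_zero (fun t ht => (hd t ht).differentiableWithinAt)
    (fun t ht => (hd t (Ico_subset_Icc_self ht)).derivWithin
      (uniqueDiffOn_Icc h.1 t (Ico_subset_Icc_self ht))) s hs

/-- A geodesic whose velocity vanishes somewhere is constant. -/
theorem eq_of_velocity_eq_zero (h : g.IsGeodesicOn x α β) (hU : IsOpen U) {s₀ : ℝ}
    (hs₀ : s₀ ∈ Icc α β) (h0 : derivWithin x (Icc α β) s₀ = 0) {s : ℝ} (hs : s ∈ Icc α β) :
    x s = x α := by
  have hz : ∀ t ∈ Icc α β, derivWithin x (Icc α β) t = 0 := by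
    intro t ht
    by_contra hne
    have := g.pos _ (h.2.1 t ht) _ hne
    rw [h.speed_eq hU ht, ← h.speed_eq hU hs₀, h0] at this
    simp at this
  exact constant_of_derivWithin_zero (h.2.2.1.differentiableOn (by norm_num))
    (fun t ht => hz t (Ico_subset_Icc_self ht)) s hs

/-- The second derivative of `φ` along a geodesic is given by its Hessian. -/
theorem hasDerivWithinAt_fderiv (h : g.IsGeodesicOn x α β) (hU : IsOpen U) {φ : Euc N → ℝ}
    (hφ : ContDiffOn ℝ 2 φ U) {s : ℝ} (hs : s ∈ Icc α β) :
    HasDerivWithinAt (fun t => g.toFun (x t) (derivWithin x (Icc α β) t) (g.grad φ (x t)))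
      (g.hess φ (x s) (derivWithin x (Icc α β) s) (derivWithin x (Icc α β) s)) (Icc α β) s := by
  have hq := h.2.1 s hs
  have hg : HasFDerivAt (g.grad φ) (fderiv ℝ (g.grad φ) (x s)) (x s) :=
    (((g.contDiffOn_grad hU hφ).differentiableOn (by norm_num)).differentiableAt
      (hU.mem_nhds hq)).hasFDerivAt
  have h1 := (h.hasDerivWithinAt_momentum hU hs).clm_apply
    (hg.comp_hasDerivWithinAt s (h.hasDerivWithinAt hs))
  refine h1.congr_deriv ?_
  rw [Function.comp_apply, g.hess_self hU φ hq, force_apply]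
  ring

end IsGeodesicOn

theorem hasDerivWithinAt_comp (g : RiemMetricOn U) (hU : IsOpen U) {φ : Euc N → ℝ}
    (hφ : ContDiffOn ℝ 2 φ U) {S : Set ℝ} {s : ℝ} {x : ℝ → Euc N} {v : Euc N} (hxU : x s ∈ U)
    (hx : HasDerivWithinAt x v S s) :
    HasDerivWithinAt (fun t => φ (x t)) (g.toFun (x s) v (g.grad φ (x s))) S s := by
  rw [g.toFun_grad_right φ hxU]
  exact ((hφ.differentiableOn (by norm_num)).differentiableAt
    (hU.mem_nhds hxU)).hasFDerivAt.comp_hasDerivWithinAt s hx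

/-- A nonconstant geodesic in `Ω` with endpoints on `∂Ω` leaves the strip where the concavity
condition holds. -/
theorem IsGeodesicOn.exists_lt_neg_width {g : RiemMetricOn U} {x : ℝ → Euc N} {α β : ℝ}
    (h : g.IsGeodesicOn x α β) (hU : IsOpen U) {φ : Euc N → ℝ} (hφ : ContDiffOn ℝ 2 φ U) {δ₀ : ℝ}
    (hδ₀ : IsConcavityWidth g φ δ₀) (hα : φ (x α) = 0) (hβ : φ (x β) = 0)
    (hneg : ∀ s ∈ Ioo α β, φ (x s) < 0) : ∃ s ∈ Ioo α β, φ (x s) < -δ₀ := by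
  have hab := h.1
  have hcont : ContinuousOn (fun s => φ (x s)) (Icc α β) := fun s hs =>
    (g.hasDerivWithinAt_comp hU hφ (h.2.1 s hs) (h.hasDerivWithinAt hs)).continuousWithinAt
  obtain ⟨s₀, hs₀, hmin⟩ := isCompact_Icc.exists_isMinOn (nonempty_Icc.2 hab.le) hcont
  have hmid : (α + β) / 2 ∈ Ioo α β := ⟨by linarith, by linarith⟩
  have hlt : φ (x s₀) < 0 := (hmin (Ioo_subset_Icc_self hmid)).trans_lt (hneg _ hmid)
  have hs₀' : s₀ ∈ Ioo α β := by
    refine ⟨lt_of_le_of_ne hs₀.1 ?_, lt_of_le_of_ne hs₀.2 ?_⟩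
    · rintro rfl
      exact hlt.ne hα
    · rintro rfl
      exact hlt.ne hβ
  refine ⟨s₀, hs₀', ?_⟩
  by_contra hge
  have hq := h.2.1 s₀ hs₀
  have hnhds : Icc α β ∈ 𝓝 s₀ := Icc_mem_nhds hs₀'.1 hs₀'.2
  set v := derivWithin x (Icc α β) with hvdef
  have hu : ∀ s ∈ Ioo α β, HasDerivAt (fun t => φ (x t))
      (g.toFun (x s) (v s) (g.grad φ (x s))) s := fun s hs =>
    (g.hasDerivWithinAt_comp hU hφ (h.2.1 s (Ioo_subset_Icc_self hs))
      (h.hasDerivWithinAt (Ioo_subset_Icc_self hs))).hasDerivAt (Icc_mem_nhds hs.1 hs.2)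
  have hderiv : deriv (fun t => φ (x t)) =ᶠ[𝓝 s₀]
      fun s => g.toFun (x s) (v s) (g.grad φ (x s)) :=
    Filter.eventually_of_mem (Ioo_mem_nhds hs₀'.1 hs₀'.2) fun s hs => (hu s hs).deriv
  have hlmin : IsLocalMin (fun t => φ (x t)) s₀ := hmin.isLocalMin hnhds
  have hw0 : g.toFun (x s₀) (v s₀) (g.grad φ (x s₀)) = 0 :=
    hlmin.hasDerivAt_eq_zero (hu s₀ hs₀')
  have hdd : deriv (deriv fun t => φ (x t)) s₀ = g.hess φ (x s₀) (v s₀) (v s₀) := by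
    rw [hderiv.deriv_eq]
    exact ((h.hasDerivWithinAt_fderiv hU hφ hs₀).hasDerivAt hnhds).deriv
  -- With zero velocity the geodesic would be constant, hence on `∂Ω`, whereas `φ` is negative at
  -- the minimum.
  by_cases hv0 : v s₀ = 0
  · exact hlt.ne ((congrArg φ (h.eq_of_velocity_eq_zero hU hs₀ hv0 hs₀)).trans hα)
  have hneg2 := (hδ₀.2 (x s₀) hq ⟨not_lt.1 hge, hlt.le.trans hδ₀.1.le⟩).2 (v s₀) hv0
    (by rw [g.symm _ hq]; exact hw0)
  have hlmax := isLocalMax_of_deriv_deriv_neg (f := fun t => φ (x t)) (x₀ := s₀)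
    (by rw [hdd]; exact hneg2)
    (by rw [(hu s₀ hs₀').deriv]; exact hw0) (hcont.continuousAt hnhds)
  -- A local minimum that is also a local maximum makes `φ ∘ x` locally constant, against its
  -- negative second derivative.
  have hconst : (fun t => φ (x t)) =ᶠ[𝓝 s₀] fun _ => φ (x s₀) := by
    filter_upwards [hlmin, hlmax] with t h1 h2
    exact le_antisymm h2 h1
  have h3 : deriv (deriv fun t => φ (x t)) s₀ = 0 := by
    rw [hconst.deriv.deriv_eq]
    simp
  rw [hdd] at h3
  exact hneg2.ne h3

/-- A constant curve is a geodesic. -/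
theorem isGeodesicOn_of_eqOn_const (g : RiemMetricOn U) {x : ℝ → Euc N} {α β : ℝ} {c : Euc N}
    (hab : α < β) (hc : c ∈ U) (hx : ∀ s ∈ Icc α β, x s = c) : g.IsGeodesicOn x α β := by
  have hd : ∀ s ∈ Icc α β, derivWithin x (Icc α β) s = 0 := fun s hs => by
    rw [derivWithin_congr hx (hx s hs)]
    simp
  refine ⟨hab, fun s hs => (hx s hs) ▸ hc, contDiffOn_const.congr hx, fun s hs => ?_⟩
  rw [covDerivAlong, derivWithin_congr hd (hd s hs), hd s hs, christoffel_zero_left]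
  simp

/-- Being a geodesic is inherited by subintervals. -/
theorem IsGeodesicOn.mono {g : RiemMetricOn U} {x : ℝ → Euc N} {α β c d : ℝ}
    (h : g.IsGeodesicOn x α β) (hcd : c < d) (hsub : Icc c d ⊆ Icc α β) :
    g.IsGeodesicOn x c d := by
  have hd : ∀ s ∈ Icc c d, derivWithin x (Icc c d) s = derivWithin x (Icc α β) s := fun s hs =>
    ((h.hasDerivWithinAt (hsub hs)).mono hsub).derivWithin (uniqueDiffOn_Icc hcd s hs)
  refine ⟨hcd, fun s hs => h.2.1 s (hsub hs), h.2.2.1.mono hsub, fun s hs => ?_⟩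
  rw [covDerivAlong, derivWithin_congr hd (hd s hs), hd s hs,
    ((h.hasDerivWithinAt_velocity (hsub hs)).mono hsub).derivWithin (uniqueDiffOn_Icc hcd s hs)]
  simp

end RiemMetricOn

/-! ### Primitives and absolutely continuous functions -/

section Calculus

variable {F : Type*} [NormedAddCommGroup F]

theorem ContinuousOn.memLp_restrict_Icc {f : ℝ → F} {α β : ℝ} (hf : ContinuousOn f (Icc α β))
    (p : ENNReal) : MemLp f p (volume.restrict (Icc α β)) := by
  obtain ⟨C, hC⟩ := isCompact_Icc.exists_bound_of_continuousOn hf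
  exact MemLp.of_bound (hf.aestronglyMeasurable_of_isCompact isCompact_Icc measurableSet_Icc) C
    ((ae_restrict_iff' measurableSet_Icc).2 (Filter.Eventually.of_forall hC))

variable [NormedSpace ℝ F]

theorem contDiffOn_succ_of_hasDerivWithinAt {f f' : ℝ → F} {α β : ℝ} {n : ℕ} (hab : α < β)
    (h : ∀ s ∈ Icc α β, HasDerivWithinAt f (f' s) (Icc α β) s)
    (h' : ContDiffOn ℝ n f' (Icc α β)) : ContDiffOn ℝ (n + 1) f (Icc α β) := by
  rw [contDiffOn_succ_iff_derivWithin (uniqueDiffOn_Icc hab)]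
  refine ⟨fun s hs => (h s hs).differentiableWithinAt, by simp, ?_⟩
  exact h'.congr fun s hs => (h s hs).derivWithin (uniqueDiffOn_Icc hab s hs)

variable [CompleteSpace F]

/-- A continuous function on a compact interval has a primitive. -/
theorem ContinuousOn.hasDerivWithinAt_integral_Icc {y : ℝ → F} {α β : ℝ} (hab : α ≤ β)
    (hy : ContinuousOn y (Icc α β)) {s : ℝ} (hs : s ∈ Icc α β) :
    HasDerivWithinAt (fun t => ∫ r in α..t, y r) (y s) (Icc α β) s := by
  -- Extending `y` by its endpoint values makes it continuous on the line, so the two-sided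
  -- fundamental theorem also covers the endpoints.
  have hY : Continuous (IccExtend hab (Set.domRestrict (Icc α β) y)) :=
    (continuousOn_iff_continuous_domRestrict.1 hy).Icc_extend'
  have hYy : ∀ t ∈ Icc α β, IccExtend hab (Set.domRestrict (Icc α β) y) t = y t := fun t ht => by
    rw [IccExtend_of_mem hab _ ht, Set.domRestrict_apply]
  have h1 : HasDerivAt (fun t => ∫ r in α..t, IccExtend hab (Set.domRestrict (Icc α β) y) r)
      (IccExtend hab (Set.domRestrict (Icc α β) y) s) s :=
    intervalIntegral.integral_hasDerivAt_right (hY.intervalIntegrable _ _)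
      hY.aestronglyMeasurable.stronglyMeasurableAtFilter hY.continuousAt
  rw [hYy s hs] at h1
  refine h1.hasDerivWithinAt.congr_of_mem (fun t ht => ?_) hs
  refine intervalIntegral.integral_congr fun r hr => ?_
  rw [uIcc_of_le ht.1] at hr
  exact (hYy r ⟨hr.1, hr.2.trans ht.2⟩).symm

/-- An absolutely continuous function whose derivative is a.e. equal to a continuous function `y`
is everywhere differentiable with derivative `y`. -/
theorem AbsolutelyContinuousOnInterval.hasDerivWithinAt_of_ae {x y : ℝ → F} {α β : ℝ} (hab : α < β)
    (hx : AbsolutelyContinuousOnInterval x α β) (hy : ContinuousOn y (Icc α β))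
    (h : ∀ᵐ s, s ∈ Icc α β → HasDerivAt x (y s) s) {s : ℝ} (hs : s ∈ Icc α β) :
    HasDerivWithinAt x (y s) (Icc α β) s := by
  have hI : ∀ t ∈ Icc α β, HasDerivWithinAt (fun t => ∫ r in α..t, y r) (y t) (Icc α β) t :=
    fun t ht => hy.hasDerivWithinAt_integral_Icc hab.le ht
  have hIac : AbsolutelyContinuousOnInterval (fun t => ∫ r in α..t, y r) α β := by
    apply ContDiffOn.absolutelyContinuousOnInterval
    rw [uIcc_of_le hab.le]
    have := contDiffOn_succ_of_hasDerivWithinAt (n := 0) hab hI (contDiffOn_zero.2 hy)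
    simpa using this
  have h₁ : ∀ᵐ s : ℝ, s ≠ α := by simp [ae_iff, measure_singleton]
  have h₂ : ∀ᵐ s : ℝ, s ≠ β := by simp [ae_iff, measure_singleton]
  -- The difference between `x` and the primitive of `y` is absolutely continuous with zero
  -- derivative a.e. The endpoints are discarded because the primitive is only known to be
  -- one-sidedly differentiable there.
  obtain ⟨C, hC⟩ := (hx.fun_sub hIac).const_of_ae_hasDerivAt_zero (by
    filter_upwards [h, h₁, h₂] with t ht hta htb htm
    rw [uIcc_of_le hab.le] at htm
    have h3 := (hI t htm).hasDerivAt
      (Icc_mem_nhds (lt_of_le_of_ne htm.1 hta.symm) (lt_of_le_of_ne htm.2 htb))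
    simpa using (ht htm).fun_sub h3)
  rw [uIcc_of_le hab.le] at hC
  refine ((hI s hs).add_const C).congr_of_mem (fun t ht => ?_) hs
  rw [← hC t ht]
  abel

end Calculus

/-! ### The du Bois-Reymond lemma -/

/-- The du Bois-Reymond lemma, with test functions in `H¹₀`. -/
theorem exists_ae_eq_const_add_integral {p f : ℝ → ℝ} {A B α β : ℝ} (hab : α < β) (hA : A ≤ α)
    (hB : β ≤ B) (hp : MemLp p 2 (volume.restrict (Icc α β))) (hf : IntegrableOn f (Icc α β))
    (h : ∀ v : ℝ → ℝ, AbsolutelyContinuousOnInterval v A B →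
      MemLp (deriv v) 2 (volume.restrict (Icc A B)) → (∀ s ∉ Ioo α β, v s = 0) →
      ∫ s in α..β, (p s * deriv v s + f s * v s) = 0) :
    ∃ c, ∀ᵐ s, s ∈ Icc α β → p s = c + ∫ t in α..s, f t := by
  have hfi : IntervalIntegrable f volume α β :=
    (intervalIntegrable_iff_integrableOn_Icc_of_le hab.le).2 hf
  set F : ℝ → ℝ := fun s => ∫ t in α..s, f t with hF
  have hFac : AbsolutelyContinuousOnInterval F α β :=
    hfi.absolutelyContinuousOnInterval_intervalIntegral left_mem_uIcc
  have hFc : ContinuousOn F (Icc α β) := by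
    have := hFac.continuousOn
    rwa [uIcc_of_le hab.le] at this
  have hq : MemLp (fun s => p s - F s) 2 (volume.restrict (Icc α β)) :=
    hp.sub (hFc.memLp_restrict_Icc 2)
  -- Subtracting the mean makes `r` integrate to zero, so that its primitive vanishes at both ends
  -- and is a legitimate test function. The goal is `r = 0` a.e.
  set c : ℝ := (β - α)⁻¹ * ∫ s in α..β, (p s - F s) with hc
  set r : ℝ → ℝ := fun s => p s - F s - c with hr
  have hr2 : MemLp r 2 (volume.restrict (Icc α β)) := hq.sub (memLp_const c)
  have hqi : IntervalIntegrable (fun s => p s - F s) volume α β :=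
    (intervalIntegrable_iff_integrableOn_Icc_of_le hab.le).2 (hq.integrable one_le_two)
  have hri : IntervalIntegrable r volume α β :=
    (intervalIntegrable_iff_integrableOn_Icc_of_le hab.le).2 (hr2.integrable one_le_two)
  have hr0 : ∫ s in α..β, r s = 0 := by
    rw [hr, intervalIntegral.integral_sub hqi (by simp), intervalIntegral.integral_const, hc,
      smul_eq_mul, ← mul_assoc, mul_inv_cancel₀ (by linarith), one_mul, sub_self]
  -- Extension by zero gives a primitive that is defined on the whole line and vanishes outside the
  -- interval.
  set e : ℝ → ℝ := (Icc α β).indicator r with he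
  have he2 : MemLp e 2 volume := (memLp_indicator_iff_restrict measurableSet_Icc).2 hr2
  have hei : Integrable e volume :=
    (integrable_indicator_iff measurableSet_Icc).2 (hr2.integrable one_le_two)
  have her : ∀ s ∈ Icc α β, e s = r s := fun s hs => indicator_of_mem hs r
  set v : ℝ → ℝ := fun s => ∫ t in α..s, e t with hv
  have hvβ : ∫ t in α..β, e t = 0 := by
    rw [← hr0]
    refine intervalIntegral.integral_congr fun t ht => her t ?_
    rwa [uIcc_of_le hab.le] at ht
  have hv0 : ∀ s ∉ Ioo α β, v s = 0 := by
    intro s hs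
    rcases le_or_gt s α with hsα | hsα
    · rw [hv, ← intervalIntegral.integral_zero (a := α) (b := s) (μ := volume) (E := ℝ)]
      refine intervalIntegral.integral_congr_uIoo fun t ht => ?_
      rw [uIoo_of_ge hsα] at ht
      exact indicator_of_notMem (fun h' => ht.2.not_ge h'.1) r
    · have hsβ : β ≤ s := not_lt.1 fun h' => hs ⟨hsα, h'⟩
      have h1 := intervalIntegral.integral_add_adjacent_intervals
        (hei.intervalIntegrable (a := α) (b := β)) (hei.intervalIntegrable (a := β) (b := s))
      have h2 : ∫ t in β..s, e t = 0 := by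
        rw [← intervalIntegral.integral_zero (a := β) (b := s) (μ := volume) (E := ℝ)]
        refine intervalIntegral.integral_congr_uIoo fun t ht => ?_
        rw [uIoo_of_le hsβ] at ht
        exact indicator_of_notMem (fun h' => ht.1.not_ge h'.2) r
      change ∫ t in α..s, e t = 0
      rw [← h1, hvβ, h2, add_zero]
  have hvd : deriv v =ᵐ[volume] e := by
    filter_upwards [LocallyIntegrable.ae_hasDerivAt_integral hei.locallyIntegrable] with s hs
    exact (hs α).deriv
  have hvac : AbsolutelyContinuousOnInterval v A B :=
    (hei.intervalIntegrable).absolutelyContinuousOnInterval_intervalIntegral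
      (by rw [uIcc_of_le (hA.trans (hab.le.trans hB))]; exact ⟨hA, hab.le.trans hB⟩)
  have hvac' : AbsolutelyContinuousOnInterval v α β := hvac.mono (by
    rw [uIcc_of_le hab.le, uIcc_of_le (hA.trans (hab.le.trans hB))]
    exact Icc_subset_Icc hA hB)
  have hvc : ContinuousOn v (Icc α β) := by
    have := hvac'.continuousOn
    rwa [uIcc_of_le hab.le] at this
  have h0 := h v hvac ((he2.restrict _).ae_eq (ae_restrict_of_ae hvd.symm)) hv0
  have hpr : IntervalIntegrable (fun s => p s * r s) volume α β :=
    (intervalIntegrable_iff_integrableOn_Icc_of_le hab.le).2 (hp.integrable_mul hr2)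
  have hFr : IntervalIntegrable (fun s => F s * r s) volume α β :=
    (intervalIntegrable_iff_integrableOn_Icc_of_le hab.le).2
      ((hFc.memLp_restrict_Icc 2).integrable_mul hr2)
  have hfv : IntervalIntegrable (fun s => f s * v s) volume α β :=
    hfi.mul_continuousOn (by rwa [uIcc_of_le hab.le])
  have hibp : ∫ s in α..β, F s * r s = -∫ s in α..β, f s * v s := by
    have h1 := hFac.integral_mul_deriv_eq_deriv_mul hvac'
    rw [hv0 α (fun h' => h'.1.false), hv0 β (fun h' => h'.2.false)] at h1
    have h2 : ∫ s in α..β, F s * deriv v s = ∫ s in α..β, F s * r s := by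
      refine intervalIntegral.integral_congr_ae ?_
      filter_upwards [hvd] with s hs hsm
      rw [uIoc_of_le hab.le] at hsm
      rw [hs, her s (Ioc_subset_Icc_self hsm)]
    have h3 : ∫ s in α..β, deriv F s * v s = ∫ s in α..β, f s * v s := by
      refine intervalIntegral.integral_congr_ae ?_
      filter_upwards [hfi.ae_hasDerivAt_integral] with s hs hsm
      rw [(hs (uIoc_subset_uIcc hsm) α left_mem_uIcc).deriv]
    rw [← h2, h1, h3]
    ring
  have h4 : ∫ s in α..β, (p s * deriv v s + f s * v s) =
      (∫ s in α..β, p s * r s) + ∫ s in α..β, f s * v s := by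
    rw [← intervalIntegral.integral_add hpr hfv]
    refine intervalIntegral.integral_congr_ae ?_
    filter_upwards [hvd] with s hs hsm
    rw [uIoc_of_le hab.le] at hsm
    rw [hs, her s (Ioc_subset_Icc_self hsm)]
  -- Integration by parts turns the hypothesis into `∫ (p - F) r = 0`, and the constant `c`
  -- contributes nothing since `∫ r = 0`.
  have h5 : ∫ s in α..β, r s * r s = 0 := by
    have h6 : ∀ s, r s * r s = p s * r s - F s * r s - c * r s := fun s => by
      rw [hr]
      ring
    simp_rw [h6]
    rw [intervalIntegral.integral_sub (hpr.sub hFr) (hri.const_mul c),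
      intervalIntegral.integral_sub hpr hFr, intervalIntegral.integral_const_mul, hr0, hibp]
    linarith
  have hrr : Integrable (fun s => r s * r s) (volume.restrict (Icc α β)) := hr2.integrable_mul hr2
  rw [intervalIntegral.integral_of_le hab.le, ← integral_Icc_eq_integral_Ioc,
    integral_eq_zero_iff_of_nonneg (fun s => mul_self_nonneg _) hrr] at h5
  refine ⟨c, ?_⟩
  filter_upwards [(ae_restrict_iff' measurableSet_Icc).1 h5] with s hs hsm
  have := mul_self_eq_zero.1 (hs hsm)
  change p s = c + F s
  linarith

/-! ### Stability of `H¹` curves under `C¹` maps -/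

theorem LipschitzOnWith.comp_absolutelyContinuousOnInterval {X Y : Type*} [PseudoMetricSpace X]
    [PseudoMetricSpace Y] {f : X → Y} {K : NNReal} {S : Set X} (hf : LipschitzOnWith K f S)
    {x : ℝ → X} {a b : ℝ} (hx : AbsolutelyContinuousOnInterval x a b) (hxS : MapsTo x (uIcc a b) S) :
    AbsolutelyContinuousOnInterval (fun s => f (x s)) a b := by
  unfold AbsolutelyContinuousOnInterval at hx ⊢
  refine squeeze_zero' (Filter.Eventually.of_forall fun E => by positivity) ?_
    (by simpa using hx.const_mul (K : ℝ))
  refine Filter.eventually_inf_principal.2 (Filter.Eventually.of_forall fun E hE => ?_)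
  rw [Finset.mul_sum]
  exact Finset.sum_le_sum fun i hi =>
    hf.dist_le_mul _ (hxS (hE.1 i hi).1) _ (hxS (hE.1 i hi).2)

/-- Compactness upgrades the local Lipschitz bounds to a global one; convexity of `K` is not needed,
so this applies to the image of a curve. -/
theorem ContDiffOn.exists_lipschitzOnWith_of_isCompact {E F : Type*} [NormedAddCommGroup E]
    [NormedSpace ℝ E] [NormedAddCommGroup F] [NormedSpace ℝ F] {f : E → F} {U K : Set E}
    (hf : ContDiffOn ℝ 1 f U) (hU : IsOpen U) (hK : IsCompact K) (hKU : K ⊆ U) :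
    ∃ C, LipschitzOnWith C f K := by
  refine LocallyLipschitzOn.exists_lipschitzOnWith_of_compact hK fun q hq => ?_
  obtain ⟨C, t, ht, h⟩ := (hf.contDiffAt (hU.mem_nhds (hKU hq))).exists_lipschitzOnWith
  exact ⟨C, t, mem_nhdsWithin_of_mem_nhds ht, h⟩

namespace IsH1

variable {N : ℕ} {x : ℝ → Euc N} {a b : ℝ}

theorem ae_differentiableAt (h : IsH1 a b x) : ∀ᵐ s, s ∈ uIcc a b → DifferentiableAt ℝ x s :=
  h.1.boundedVariationOn.ae_differentiableAt_of_mem_uIcc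

/-- By the chain rule, a field `ψ • W(x)` has a derivative bounded by an affine function of `‖x'‖`,
and this suffices for square integrability. -/
theorem of_ae_bound (h : IsH1 a b x) {V : ℝ → Euc N} (hV : AbsolutelyContinuousOnInterval V a b)
    {A B : ℝ} (hb : ∀ᵐ s, s ∈ Icc a b → ‖deriv V s‖ ≤ A + B * ‖deriv x s‖) : IsH1 a b V := by
  refine ⟨hV, ?_⟩
  have hg : MemLp (fun s => A + B * ‖deriv x s‖) 2 (volume.restrict (Icc a b)) :=
    (memLp_const A).add (h.2.norm.const_mul B)
  exact hg.mono' (stronglyMeasurable_deriv V).aestronglyMeasurable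
    ((ae_restrict_iff' measurableSet_Icc).2 hb)

theorem of_contDiff {V : ℝ → Euc N} (hV : ContDiff ℝ 1 V) : IsH1 a b V :=
  ⟨hV.contDiffOn.absolutelyContinuousOnInterval,
    (hV.continuous_deriv le_rfl).continuousOn.memLp_restrict_Icc 2⟩

theorem smul_const {v : ℝ → ℝ} (hab : a ≤ b) (hv : AbsolutelyContinuousOnInterval v a b)
    (hv' : MemLp (deriv v) 2 (volume.restrict (Icc a b))) (w : Euc N) :
    IsH1 a b (fun s => v s • w) := by
  refine ⟨?_, ?_⟩
  · exact hv.fun_smul (g := fun _ => w)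
      (contDiffOn_const (n := 1)).absolutelyContinuousOnInterval
  · have h1 : MemLp (fun s => deriv v s • w) 2 (volume.restrict (Icc a b)) :=
      ((ContinuousLinearMap.id ℝ ℝ).smulRight w).comp_memLp' hv'
    refine h1.ae_eq ((ae_restrict_iff' measurableSet_Icc).2 ?_)
    filter_upwards [hv.ae_differentiableAt] with s hs hsm
    rw [uIcc_of_le hab] at hs
    rw [deriv_smul_const (hs hsm)]

/-- The composition with a `C¹` map, multiplied by a `C¹` scalar function. -/
theorem contDiff_smul_comp (h : IsH1 a b x) (hab : a ≤ b) {U : Set (Euc N)} (hU : IsOpen U)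
    (hxU : ∀ s ∈ Icc a b, x s ∈ U) {W : Euc N → Euc N} (hW : ContDiffOn ℝ 1 W U) {ψ : ℝ → ℝ}
    (hψ : ContDiff ℝ 1 ψ) :
    IsH1 a b (fun s => ψ s • W (x s)) ∧ ∀ᵐ s, s ∈ Icc a b → HasDerivAt (fun s => ψ s • W (x s))
      (ψ s • fderiv ℝ W (x s) (deriv x s) + deriv ψ s • W (x s)) s := by
  have hxc : ContinuousOn x (Icc a b) := by
    have := h.1.continuousOn
    rwa [uIcc_of_le hab] at this
  have hd : ∀ᵐ s, s ∈ Icc a b → HasDerivAt (fun s => ψ s • W (x s))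
      (ψ s • fderiv ℝ W (x s) (deriv x s) + deriv ψ s • W (x s)) s := by
    filter_upwards [h.ae_differentiableAt] with s hs hsm
    rw [uIcc_of_le hab] at hs
    have h1 := ((hW.differentiableOn (by norm_num)).differentiableAt
      (hU.mem_nhds (hxU s hsm))).hasFDerivAt.comp_hasDerivAt s (hs hsm).hasDerivAt
    exact ((hψ.differentiable (by norm_num)) s).hasDerivAt.smul h1
  obtain ⟨K, hK⟩ := hW.exists_lipschitzOnWith_of_isCompact hU (isCompact_Icc.image_of_continuousOn hxc)
    (image_subset_iff.2 hxU)
  have hWx : ContinuousOn (fun s => W (x s)) (Icc a b) := hW.continuousOn.comp hxc hxU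
  have hDx : ContinuousOn (fun s => fderiv ℝ W (x s)) (Icc a b) :=
    (hW.continuousOn_fderiv_of_isOpen hU (by norm_num)).comp hxc hxU
  obtain ⟨A, hA⟩ := isCompact_Icc.exists_bound_of_continuousOn
    ((hψ.continuous_deriv le_rfl).continuousOn.smul hWx)
  obtain ⟨B, hB⟩ := isCompact_Icc.exists_bound_of_continuousOn
    (hψ.continuous.continuousOn.smul hDx)
  refine ⟨h.of_ae_bound (A := A) (B := B) ?_ ?_, hd⟩
  · refine AbsolutelyContinuousOnInterval.fun_smul
      hψ.contDiffOn.absolutelyContinuousOnInterval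
      (hK.comp_absolutelyContinuousOnInterval h.1 ?_)
    rw [uIcc_of_le hab]
    exact mapsTo_image x _
  · filter_upwards [hd] with s hs hsm
    rw [(hs hsm).deriv, add_comm]
    refine (norm_add_le _ _).trans (add_le_add (hA s hsm) ?_)
    exact (((ψ s • fderiv ℝ W (x s)).le_opNorm (deriv x s))).trans
      (mul_le_mul_of_nonneg_right (hB s hsm) (norm_nonneg _))

end IsH1

/-! ### The first variation of the energy and its integrability -/

namespace RiemMetricOn

variable {N : ℕ} {U : Set (Euc N)}

/-- A `C¹` curve solving the geodesic equation is a geodesic. -/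
theorem isGeodesicOn_of_hasDerivWithinAt (g : RiemMetricOn U) (hU : IsOpen U) {x v : ℝ → Euc N}
    {α β : ℝ} (hab : α < β) (hxU : ∀ s ∈ Icc α β, x s ∈ U)
    (hx : ∀ s ∈ Icc α β, HasDerivWithinAt x (v s) (Icc α β) s)
    (hv : ∀ s ∈ Icc α β, HasDerivWithinAt v (-g.christoffel (x s) (v s) (v s)) (Icc α β) s) :
    g.IsGeodesicOn x α β := by
  have hxc : ContinuousOn x (Icc α β) := fun s hs => (hx s hs).continuousWithinAt
  have hvc : ContinuousOn v (Icc α β) := fun s hs => (hv s hs).continuousWithinAt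
  have hd : ∀ s ∈ Icc α β, derivWithin x (Icc α β) s = v s := fun s hs =>
    (hx s hs).derivWithin (uniqueDiffOn_Icc hab s hs)
  have hv1 : ContDiffOn ℝ 1 v (Icc α β) := by
    simpa using contDiffOn_succ_of_hasDerivWithinAt (n := 0) hab hv
      (contDiffOn_zero.2 (g.continuousOn_christoffel_comp hU hxc hxU hvc hvc).neg)
  refine ⟨hab, hxU, ?_, fun s hs => ?_⟩
  · have h2 := contDiffOn_succ_of_hasDerivWithinAt (n := 1) hab hx hv1
    norm_num at h2
    exact h2
  · rw [covDerivAlong, derivWithin_congr hd (hd s hs), hd s hs,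
      (hv s hs).derivWithin (uniqueDiffOn_Icc hab s hs)]
    simp

/-- The integrand of the first variation of the energy in the direction `V`. -/
noncomputable def firstVariation (g : RiemMetricOn U) (x V : ℝ → Euc N) (s : ℝ) : ℝ :=
  g.toFun (x s) (deriv x s) (deriv V s) + g.force (x s) (deriv x s) (V s)

/-- Pairing `Γ(x', V)` with `x'` leaves only the derivative of the metric in direction `V`. Only
interior parameters are treated, where `derivWithin` is `deriv`; the endpoints are negligible under
the integral. -/
theorem toFun_covDerivAlong (g : RiemMetricOn U) (hU : IsOpen U) {x : ℝ → Euc N} (V : ℝ → Euc N)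
    {a b s : ℝ} (hs : s ∈ Ioo a b) (hxU : x s ∈ U) :
    g.toFun (x s) (derivWithin x (Icc a b) s) (g.covDerivAlong (Icc a b) x V s) =
      g.firstVariation x V s := by
  have hn : Icc a b ∈ 𝓝 s := Icc_mem_nhds hs.1 hs.2
  rw [covDerivAlong, derivWithin_of_mem_nhds hn, derivWithin_of_mem_nhds hn, map_add,
    g.toFun_christoffel_right hU hxU, firstVariation, force_apply]

variable {g : RiemMetricOn U} {x : ℝ → Euc N} {a b : ℝ}

theorem memLp_momentum (hx : IsH1 a b x) (hab : a ≤ b) (hxU : ∀ s ∈ Icc a b, x s ∈ U) :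
    MemLp (fun s => g.toFun (x s) (deriv x s)) 2 (volume.restrict (Icc a b)) := by
  have hxc : ContinuousOn x (Icc a b) := by
    have := hx.1.continuousOn
    rwa [uIcc_of_le hab] at this
  have hgc : ContinuousOn (fun s => g.toFun (x s)) (Icc a b) :=
    g.contDiffOn.continuousOn.comp hxc hxU
  obtain ⟨C, hC⟩ := isCompact_Icc.exists_bound_of_continuousOn hgc
  refine MemLp.of_le_mul (c := C) hx.2 ?_ ((ae_restrict_iff' measurableSet_Icc).2
    (Filter.Eventually.of_forall fun s hs => ((g.toFun (x s)).le_opNorm _).trans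
      (mul_le_mul_of_nonneg_right (hC s hs) (norm_nonneg _))))
  exact isBoundedBilinearMap_apply.continuous.comp_aestronglyMeasurable
    ((hgc.aestronglyMeasurable_of_isCompact isCompact_Icc measurableSet_Icc).prodMk
      (stronglyMeasurable_deriv x).aestronglyMeasurable)

theorem continuous_force_aux :
    Continuous fun p : (Euc N →L[ℝ] Euc N →L[ℝ] Euc N →L[ℝ] ℝ) × Euc N =>
      (1 / 2 : ℝ) • ((p.1.flip p.2).flip p.2) := by
  have h3 : Continuous fun p : (Euc N →L[ℝ] Euc N →L[ℝ] Euc N →L[ℝ] ℝ) × Euc N => p.1.flip :=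
    (ContinuousLinearMap.flipₗᵢ ℝ (Euc N) (Euc N) (Euc N →L[ℝ] ℝ)).continuous.comp continuous_fst
  have h4 : Continuous fun p : (Euc N →L[ℝ] Euc N →L[ℝ] Euc N →L[ℝ] ℝ) × Euc N =>
      (p.1.flip p.2).flip :=
    (ContinuousLinearMap.flipₗᵢ ℝ (Euc N) (Euc N) ℝ).continuous.comp (h3.clm_apply continuous_snd)
  exact (h4.clm_apply continuous_snd).const_smul (1 / 2 : ℝ)

theorem norm_force_le (g : RiemMetricOn U) (q v : Euc N) :
    ‖g.force q v‖ ≤ ‖fderiv ℝ g.toFun q‖ * (‖v‖ * ‖v‖) := by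
  refine ContinuousLinearMap.opNorm_le_bound _ (by positivity) fun w => ?_
  rw [force_apply, norm_mul]
  have h1 : ‖fderiv ℝ g.toFun q w v v‖ ≤ ‖fderiv ℝ g.toFun q‖ * ‖w‖ * ‖v‖ * ‖v‖ := by
    refine (ContinuousLinearMap.le_opNorm _ _).trans
      (mul_le_mul_of_nonneg_right ?_ (norm_nonneg _))
    refine (ContinuousLinearMap.le_opNorm _ _).trans
      (mul_le_mul_of_nonneg_right ?_ (norm_nonneg _))
    exact ContinuousLinearMap.le_opNorm _ _
  have h3 : ‖(1 / 2 : ℝ)‖ ≤ 1 := by norm_num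
  calc ‖(1 / 2 : ℝ)‖ * ‖fderiv ℝ g.toFun q w v v‖
      ≤ 1 * (‖fderiv ℝ g.toFun q‖ * ‖w‖ * ‖v‖ * ‖v‖) :=
        mul_le_mul h3 h1 (norm_nonneg _) zero_le_one
    _ = ‖fderiv ℝ g.toFun q‖ * (‖v‖ * ‖v‖) * ‖w‖ := by ring

/-- The force is quadratic in the velocity, so an `H¹` curve yields only `L¹`; the du Bois-Reymond
lemma asks no more of `f`. -/
theorem integrableOn_force (hU : IsOpen U) (hx : IsH1 a b x) (hab : a ≤ b)
    (hxU : ∀ s ∈ Icc a b, x s ∈ U) :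
    IntegrableOn (fun s => g.force (x s) (deriv x s)) (Icc a b) := by
  have hxc : ContinuousOn x (Icc a b) := by
    have := hx.1.continuousOn
    rwa [uIcc_of_le hab] at this
  have hgc : ContinuousOn (fun s => fderiv ℝ g.toFun (x s)) (Icc a b) :=
    (g.continuousOn_fderiv hU).comp hxc hxU
  obtain ⟨C, hC⟩ := isCompact_Icc.exists_bound_of_continuousOn hgc
  have hm : AEStronglyMeasurable (fun s => g.force (x s) (deriv x s)) (volume.restrict (Icc a b)) := by
    have m1 : AEStronglyMeasurable (fun s => fderiv ℝ g.toFun (x s)) (volume.restrict (Icc a b)) :=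
      hgc.aestronglyMeasurable_of_isCompact isCompact_Icc measurableSet_Icc
    have m2 := m1.prodMk (stronglyMeasurable_deriv x).aestronglyMeasurable
    have m3 := continuous_force_aux.comp_aestronglyMeasurable m2
    exact m3
  have h2 : Integrable (fun s => C * (‖deriv x s‖ * ‖deriv x s‖)) (volume.restrict (Icc a b)) :=
    (hx.2.norm.integrable_mul hx.2.norm).const_mul C
  exact h2.mono' hm ((ae_restrict_iff' measurableSet_Icc).2
    (Filter.Eventually.of_forall fun s hs => (g.norm_force_le _ _).trans
      (mul_le_mul_of_nonneg_right (hC s hs) (by positivity))))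

end RiemMetricOn

/-! ### Consequences of criticality inside `Ω` and on `∂Ω` -/

namespace RiemMetricOn

variable {N : ℕ} {U : Set (Euc N)} {g : RiemMetricOn U} {φ : Euc N → ℝ} {x : ℝ → Euc N}
  {a b α β : ℝ}

theorem integrableOn_firstVariation (hU : IsOpen U) (hx : IsH1 a b x) (hab : a ≤ b)
    (hxU : ∀ s ∈ Icc a b, x s ∈ U) {V : ℝ → Euc N} (hV : IsH1 a b V) :
    IntegrableOn (g.firstVariation x V) (Icc a b) := by
  have hVc : ContinuousOn V (Icc a b) := by
    have := hV.1.continuousOn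
    rwa [uIcc_of_le hab] at this
  obtain ⟨C, hC⟩ := isCompact_Icc.exists_bound_of_continuousOn hVc
  have hp := memLp_momentum (g := g) hx hab hxU
  have hf := integrableOn_force (g := g) hU hx hab hxU
  have h1 : Integrable (fun s => g.toFun (x s) (deriv x s) (deriv V s))
      (volume.restrict (Icc a b)) := by
    refine (hp.norm.integrable_mul hV.2.norm).mono'
      (isBoundedBilinearMap_apply.continuous.comp_aestronglyMeasurable
        (hp.aestronglyMeasurable.prodMk hV.2.aestronglyMeasurable))
      (Filter.Eventually.of_forall fun s => ContinuousLinearMap.le_opNorm _ _)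
  have h2 : Integrable (fun s => g.force (x s) (deriv x s) (V s))
      (volume.restrict (Icc a b)) := by
    refine (hf.norm.mul_const C).mono'
      (isBoundedBilinearMap_apply.continuous.comp_aestronglyMeasurable
        (hf.aestronglyMeasurable.prodMk
          (hVc.aestronglyMeasurable_of_isCompact isCompact_Icc measurableSet_Icc)))
      ((ae_restrict_iff' measurableSet_Icc).2 (Filter.Eventually.of_forall fun s hs => ?_))
    exact (ContinuousLinearMap.le_opNorm _ _).trans
      (mul_le_mul_of_nonneg_left (hC s hs) (norm_nonneg _))
  exact h1.add h2

theorem firstVariation_nonneg (hU : IsOpen U) (hab : a ≤ b) (hxU : ∀ s ∈ Icc a b, x s ∈ U)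
    (hcrit : IsVarCriticalPortion g φ x a b) {V : ℝ → Euc N} (hV : V ∈ outwardCone g φ x) :
    0 ≤ ∫ s in a..b, g.firstVariation x V s := by
  refine (hcrit.2 V hV).trans_eq (intervalIntegral.integral_congr_uIoo fun s hs => ?_)
  rw [uIoo_of_le hab] at hs
  exact g.toFun_covDerivAlong hU V hs (hxU s (Ioo_subset_Icc_self hs))

theorem firstVariation_nonneg_of_support (hU : IsOpen U) (hab : a ≤ b)
    (hxU : ∀ s ∈ Icc a b, x s ∈ U) (hcrit : IsVarCriticalPortion g φ x a b) (hα : a ≤ α)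
    (hαβ : α < β) (hβ : β ≤ b) {V : ℝ → Euc N} (hV : V ∈ outwardCone g φ x)
    (hV0 : ∀ s ∉ Ioo α β, V s = 0) : 0 ≤ ∫ s in α..β, g.firstVariation x V s := by
  refine (firstVariation_nonneg hU hab hxU hcrit hV).trans_eq ?_
  rw [intervalIntegral.integral_of_le hab, intervalIntegral.integral_of_le hαβ.le,
    ← integral_Icc_eq_integral_Ioc, ← integral_Icc_eq_integral_Ioc]
  refine setIntegral_eq_of_subset_of_forall_sdiff_eq_zero measurableSet_Icc
    (Icc_subset_Icc hα hβ) fun s hs => ?_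
  -- Off the closed interval `V` vanishes on a neighbourhood, so its derivative vanishes too.
  have h0 : V =ᶠ[𝓝 s] fun _ => 0 :=
    Filter.eventually_of_mem (isClosed_Icc.isOpen_compl.mem_nhds hs.2)
      fun t ht => hV0 t fun h => ht (Ioo_subset_Icc_self h)
  rw [firstVariation, h0.deriv_eq, h0.eq_of_nhds]
  simp

/-- Portions of a variationally critical curve in `Ω` are geodesics, up to their endpoints. -/
theorem isGeodesicOn_of_mem_domain (hU : IsOpen U) (hx : IsH1 0 1 x)
    (hxU : ∀ s ∈ Icc (0 : ℝ) 1, x s ∈ U) (ha : 0 ≤ a) (hb : b ≤ 1) (hab : a ≤ b)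
    (hcrit : IsVarCriticalPortion g φ x a b) (hα : a ≤ α) (hαβ : α < β) (hβ : β ≤ b)
    (hΩ : ∀ s ∈ Ioo α β, x s ∈ domainOf U φ) : g.IsGeodesicOn x α β := by
  have hsub : Icc α β ⊆ Icc 0 1 := Icc_subset_Icc (ha.trans hα) (hβ.trans hb)
  have hxab : ∀ s ∈ Icc a b, x s ∈ U := fun s hs => hxU s (Icc_subset_Icc ha hb hs)
  have hpL2 : MemLp (fun s => g.toFun (x s) (deriv x s)) 2 (volume.restrict (Icc α β)) :=
    (memLp_momentum hx zero_le_one hxU).mono_measure (Measure.restrict_mono hsub le_rfl)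
  have hfL1 : IntegrableOn (fun s => g.force (x s) (deriv x s)) (Icc α β) :=
    (integrableOn_force hU hx zero_le_one hxU).mono_set hsub
  have hfint : ∀ s ∈ Icc α β,
      IntervalIntegrable (fun s => g.force (x s) (deriv x s)) volume α s := fun s hs =>
    (intervalIntegrable_iff_integrableOn_Icc_of_le hs.1).2
      (hfL1.mono_set (Icc_subset_Icc_right hs.2))
  -- The field `v • w` vanishes at every contact parameter, so it lies in the cone for every sign of
  -- `v` and `w`; replacing `w` by `-w` later turns the inequality into an equality.
  have hcone : ∀ (v : ℝ → ℝ) (w : Euc N), AbsolutelyContinuousOnInterval v 0 1 →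
      MemLp (deriv v) 2 (volume.restrict (Icc 0 1)) → (∀ s ∉ Ioo α β, v s = 0) →
      0 ≤ ∫ s in α..β, (g.toFun (x s) (deriv x s) w * deriv v s
        + g.force (x s) (deriv x s) w * v s) := by
    intro v w hv hv' hv0
    have hVc : (fun s => v s • w) ∈ outwardCone g φ x := by
      refine ⟨IsH1.smul_const zero_le_one hv hv' w, fun s _ hs => ?_⟩
      have : s ∉ Ioo α β := fun h => (hΩ s h).2.ne hs.2
      simp [hv0 s this]
    refine (firstVariation_nonneg_of_support hU hab hxab hcrit hα hαβ hβ hVc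
      fun s hs => by simp [hv0 s hs]).trans_eq ?_
    refine intervalIntegral.integral_congr_ae ?_
    filter_upwards [hv.ae_differentiableAt] with s hs hsm
    rw [uIoc_of_le hαβ.le] at hsm
    rw [uIcc_of_le zero_le_one] at hs
    rw [firstVariation, deriv_smul_const (hs (hsub (Ioc_subset_Icc_self hsm)))]
    simp only [map_smul, smul_eq_mul]
    ring
  have hdbr : ∀ w : Euc N, ∃ c, ∀ᵐ s, s ∈ Icc α β → g.toFun (x s) (deriv x s) w =
      c + ∫ t in α..s, g.force (x t) (deriv x t) w := by
    intro w
    refine exists_ae_eq_const_add_integral (A := 0) (B := 1) hαβ (ha.trans hα) (hβ.trans hb)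
      ((ContinuousLinearMap.apply ℝ ℝ w).comp_memLp' hpL2)
      ((ContinuousLinearMap.apply ℝ ℝ w).integrable_comp hfL1) fun v hv hv' hv0 => ?_
    refine le_antisymm ?_ (hcone v w hv hv' hv0)
    have h1 := hcone v (-w) hv hv' hv0
    have h2 : ∀ s, g.toFun (x s) (deriv x s) (-w) * deriv v s
        + g.force (x s) (deriv x s) (-w) * v s = -(g.toFun (x s) (deriv x s) w * deriv v s
        + g.force (x s) (deriv x s) w * v s) := fun s => by
      rw [map_neg, map_neg]
      ring
    simp_rw [h2] at h1
    rw [intervalIntegral.integral_neg] at h1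
    exact neg_nonneg.1 h1
  choose c hc using hdbr
  -- The exceptional null set depends on `w`, so only the finitely many basis vectors are used;
  -- linearity recovers the rest.
  have hcall : ∀ᵐ s, s ∈ Icc α β → ∀ i : Fin N,
      g.toFun (x s) (deriv x s) (EuclideanSpace.basisFun (Fin N) ℝ i) =
      c (EuclideanSpace.basisFun (Fin N) ℝ i) +
        (∫ t in α..s, g.force (x t) (deriv x t)) (EuclideanSpace.basisFun (Fin N) ℝ i) := by
    filter_upwards [ae_all_iff.2 fun i => hc (EuclideanSpace.basisFun (Fin N) ℝ i)] with s hs hsm i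
    rw [hs i hsm, ContinuousLinearMap.intervalIntegral_apply (hfint s hsm)]
  set C : Euc N →L[ℝ] ℝ := LinearMap.toContinuousLinearMap
    ((EuclideanSpace.basisFun (Fin N) ℝ).toBasis.constr ℝ
      fun i => c (EuclideanSpace.basisFun (Fin N) ℝ i)) with hC
  have hCi : ∀ i, C (EuclideanSpace.basisFun (Fin N) ℝ i) =
      c (EuclideanSpace.basisFun (Fin N) ℝ i) := fun i => by
    simp [hC]
  set P : ℝ → (Euc N →L[ℝ] ℝ) := fun s => C + ∫ t in α..s, g.force (x t) (deriv x t) with hP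
  -- `P` is the continuous representative of the momentum and `y` that of the velocity. Since `x' =
  -- y` a.e. and `x` is absolutely continuous, `x` is `C¹`.
  set y : ℝ → Euc N := fun s => g.sharp (x s) (P s) with hy
  have hpP : ∀ᵐ s, s ∈ Icc α β → HasDerivAt x (y s) s := by
    filter_upwards [hcall, hx.ae_differentiableAt] with s hs hd hsm
    rw [uIcc_of_le zero_le_one] at hd
    have h1 : g.toFun (x s) (deriv x s) = P s := by
      have h2 : (g.toFun (x s) (deriv x s) : Euc N →ₗ[ℝ] ℝ) = (P s : Euc N →ₗ[ℝ] ℝ) := by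
        refine (EuclideanSpace.basisFun (Fin N) ℝ).toBasis.ext fun i => ?_
        have := hs hsm i
        rw [← hCi] at this
        simpa [hP] using this
      exact ContinuousLinearMap.coe_injective h2
    have h3 : y s = deriv x s := by
      rw [hy]
      dsimp only
      rw [← h1, g.sharp_toFun (hxU s (hsub hsm))]
    rw [h3]
    exact (hd (hsub hsm)).hasDerivAt
  have hxc : ContinuousOn x (Icc α β) := by
    have := hx.1.continuousOn
    rw [uIcc_of_le zero_le_one] at this
    exact this.mono hsub
  have hPc : ContinuousOn P (Icc α β) := by
    refine continuousOn_const.add ?_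
    have := intervalIntegral.continuousOn_primitive_interval (μ := volume) (a := α) (b := β)
      (f := fun s => g.force (x s) (deriv x s)) (by rwa [uIcc_of_le hαβ.le])
    rwa [uIcc_of_le hαβ.le] at this
  have hyc : ContinuousOn y (Icc α β) :=
    (g.contDiffOn_sharp.continuousOn.comp hxc fun s hs => hxU s (hsub hs)).clm_apply hPc
  have hxac : AbsolutelyContinuousOnInterval x α β := hx.1.mono (by
    rw [uIcc_of_le hαβ.le, uIcc_of_le zero_le_one]
    exact hsub)
  have hxd : ∀ s ∈ Icc α β, HasDerivWithinAt x (y s) (Icc α β) s := fun s hs =>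
    hxac.hasDerivWithinAt_of_ae hαβ hyc hpP hs
  have hkc : ContinuousOn (fun s => g.force (x s) (y s)) (Icc α β) :=
    g.continuousOn_force_comp hU hxc (fun s hs => hxU s (hsub hs)) hyc
  -- Bootstrap: with a continuous velocity the force is continuous, so `P` is differentiable
  -- everywhere, and so is `y` because `sharp` is `C¹`.
  have hPd : ∀ s ∈ Icc α β, HasDerivWithinAt P (g.force (x s) (y s)) (Icc α β) s := by
    intro s hs
    refine ((hkc.hasDerivWithinAt_integral_Icc hαβ.le hs).const_add C).congr_of_mem
      (fun t ht => ?_) hs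
    refine congrArg (C + ·) (intervalIntegral.integral_congr_ae ?_)
    filter_upwards [hpP] with r hr hrm
    rw [uIoc_of_le ht.1] at hrm
    rw [(hr ⟨hrm.1.le, hrm.2.trans ht.2⟩).deriv]
  refine g.isGeodesicOn_of_hasDerivWithinAt hU hαβ (fun s hs => hxU s (hsub hs)) hxd
    fun s hs => ?_
  have hq := hxU s (hsub hs)
  have hyd : DifferentiableWithinAt ℝ y (Icc α β) s := by
    have h1 : DifferentiableAt ℝ g.sharp (x s) :=
      (g.contDiffOn_sharp.differentiableOn (by norm_num)).differentiableAt (hU.mem_nhds hq)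
    exact ((h1.hasFDerivAt.comp_hasDerivWithinAt s (hxd s hs)).clm_apply
      (hPd s hs)).differentiableWithinAt
  have hud := uniqueDiffOn_Icc hαβ s hs
  have h1 := g.hasDerivWithinAt_momentum hU hq (hxd s hs) hyd.hasDerivWithinAt
  have h2 := (hPd s hs).congr_of_mem (fun t ht => g.toFun_sharp (hxU t (hsub ht)) (P t)) hs
  have h3 := (h1.derivWithin hud).symm.trans (h2.derivWithin hud)
  rw [← eq_neg_of_add_eq_zero_left ((g.geodesic_eq_iff hq _ _).2 h3)]
  exact hyd.hasDerivWithinAt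

/-- A variationally critical curve is constant on the intervals it spends on `∂Ω`. -/
theorem eq_of_forall_mem_boundary (hU : IsOpen U) (hφ : ContDiffOn ℝ 2 φ U)
    (hconc : StronglyConcave g φ) (hx : IsH1 0 1 x)
    (hxU : ∀ s ∈ Icc (0 : ℝ) 1, x s ∈ U) (ha : 0 ≤ a) (hb : b ≤ 1) (hab : a ≤ b)
    (hcrit : IsVarCriticalPortion g φ x a b) (hα : a ≤ α) (hαβ : α < β) (hβ : β ≤ b)
    (hΩ : ∀ s ∈ Icc α β, x s ∈ boundaryOf U φ) : ∀ s ∈ Icc α β, x s = x α := by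
  have hsub : Icc α β ⊆ Icc 0 1 := Icc_subset_Icc (ha.trans hα) (hβ.trans hb)
  have hxab : ∀ s ∈ Icc a b, x s ∈ U := fun s hs => hxU s (Icc_subset_Icc ha hb hs)
  -- The outer radius is half the length, so `ψ` is positive exactly on the open interval.
  let ψ : ContDiffBump ((α + β) / 2) :=
    ⟨(β - α) / 4, (β - α) / 2, by linarith, by linarith⟩
  have hψsupp : Function.support ψ = Ioo α β := by
    rw [ψ.support_eq, Real.ball_eq_Ioo]
    congr 1 <;> simp only [ψ] <;> ring
  obtain ⟨hVH, hVd⟩ := hx.contDiff_smul_comp zero_le_one hU hxU (g.contDiffOn_grad hU hφ)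
    (ψ.contDiff (n := 1))
  have hVc : (fun s => ψ s • g.grad φ (x s)) ∈ outwardCone g φ x := by
    refine ⟨hVH, fun s hs _ => ?_⟩
    rw [map_smul, smul_apply, smul_eq_mul]
    refine mul_nonneg ψ.nonneg ?_
    by_cases h0 : g.grad φ (x s) = 0
    · simp [h0]
    · exact (g.pos _ (hxU s hs) _ h0).le
  have hnn := firstVariation_nonneg_of_support hU hab hxab hcrit hα hαβ hβ hVc fun s hs => by
    have : ψ s = 0 := by
      rw [← hψsupp] at hs
      exact Function.notMem_support.1 hs
    simp [this]
  have htan : ∀ s ∈ Ioo α β, DifferentiableAt ℝ x s →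
      g.toFun (x s) (deriv x s) (g.grad φ (x s)) = 0 := by
    intro s hs hd
    have h1 := (g.hasDerivWithinAt_comp hU hφ (hΩ s (Ioo_subset_Icc_self hs)).1
      (hd.hasDerivAt.hasDerivWithinAt (s := univ)))
    rw [hasDerivWithinAt_univ] at h1
    have h2 : (fun t => φ (x t)) =ᶠ[𝓝 s] fun _ => 0 :=
      Filter.eventually_of_mem (Icc_mem_nhds hs.1 hs.2) fun t ht => (hΩ t ht).2
    rw [← h1.deriv, h2.deriv_eq]
    simp
  -- The term with `ψ'` carries the factor `g(x', ∇φ)`, which is zero by tangency.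
  have hfv : ∀ᵐ s, s ∈ Ioo α β → g.firstVariation x (fun s => ψ s • g.grad φ (x s)) s =
      ψ s * g.hess φ (x s) (deriv x s) (deriv x s) := by
    filter_upwards [hVd, hx.ae_differentiableAt] with s hs hd hsm
    have hm := hsub (Ioo_subset_Icc_self hsm)
    rw [uIcc_of_le zero_le_one] at hd
    rw [firstVariation, (hs hm).deriv, g.hess_self hU φ (hxU s hm), map_add, map_smul, map_smul,
      htan s hsm (hd hm), map_smul, force_apply]
    simp only [smul_eq_mul]
    ring
  have hle : ∀ᵐ s, s ∈ Ioo α β → ψ s * g.hess φ (x s) (deriv x s) (deriv x s) ≤ 0 ∧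
      (ψ s * g.hess φ (x s) (deriv x s) (deriv x s) = 0 → HasDerivAt x 0 s) := by
    filter_upwards [hx.ae_differentiableAt] with s hd hsm
    have hm := hsub (Ioo_subset_Icc_self hsm)
    rw [uIcc_of_le zero_le_one] at hd
    have hψ : 0 < ψ s := lt_of_le_of_ne ψ.nonneg (Ne.symm (by
      rw [← hψsupp] at hsm
      exact hsm))
    by_cases h0 : deriv x s = 0
    · have hz : g.hess φ (x s) 0 0 = 0 := by simp [hess]
      rw [h0, hz, mul_zero]
      exact ⟨le_rfl, fun _ => h0 ▸ (hd hm).hasDerivAt⟩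
    · have h1 := hconc (x s) (hΩ s (Ioo_subset_Icc_self hsm)) _ h0 (by
        rw [← g.toFun_grad_right φ (hxU s hm)]
        exact htan s hsm (hd hm))
      have h2 := mul_neg_of_pos_of_neg hψ h1
      exact ⟨h2.le, fun h => absurd h h2.ne⟩
  have hxac : AbsolutelyContinuousOnInterval x α β := hx.1.mono (by
    rw [uIcc_of_le hαβ.le, uIcc_of_le zero_le_one]
    exact hsub)
  have hα' : ∀ᵐ s : ℝ, s ≠ α := by simp [ae_iff, measure_singleton]
  have hβ' : ∀ᵐ s : ℝ, s ≠ β := by simp [ae_iff, measure_singleton]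
  -- Criticality makes the integral nonnegative and concavity makes the integrand nonpositive.
  have hzero : ∀ᵐ s, s ∈ Icc α β → g.firstVariation x (fun s => ψ s • g.grad φ (x s)) s = 0 := by
    have hle' : 0 ≤ᵐ[volume.restrict (Icc α β)]
        fun s => -g.firstVariation x (fun s => ψ s • g.grad φ (x s)) s := by
      rw [Filter.EventuallyLE, ae_restrict_iff' measurableSet_Icc]
      filter_upwards [hfv, hle, hα', hβ'] with s h1 h2 hsα hsβ hsm
      have hm : s ∈ Ioo α β := ⟨lt_of_le_of_ne hsm.1 hsα.symm, lt_of_le_of_ne hsm.2 hsβ⟩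
      rw [h1 hm]
      exact neg_nonneg.2 (h2 hm).1
    have hint := ((integrableOn_firstVariation (g := g) hU hx zero_le_one hxU hVH).mono_set hsub).neg
    rw [intervalIntegral.integral_of_le hαβ.le, ← integral_Icc_eq_integral_Ioc] at hnn
    have h0 : ∫ s in Icc α β, -g.firstVariation x (fun s => ψ s • g.grad φ (x s)) s = 0 := by
      refine le_antisymm ?_ (integral_nonneg_of_ae hle')
      rw [integral_neg]
      exact neg_nonpos.2 hnn
    rw [integral_eq_zero_iff_of_nonneg_ae hle' hint, Filter.EventuallyEq,
      ae_restrict_iff' measurableSet_Icc] at h0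
    filter_upwards [h0] with s hs hsm
    exact neg_eq_zero.1 (hs hsm)
  obtain ⟨c, hc⟩ := hxac.const_of_ae_hasDerivAt_zero (by
    filter_upwards [hzero, hfv, hle, hα', hβ'] with s h0 h1 h2 hsα hsβ hsm
    rw [uIcc_of_le hαβ.le] at hsm
    have hm : s ∈ Ioo α β := ⟨lt_of_le_of_ne hsm.1 hsα.symm, lt_of_le_of_ne hsm.2 hsβ⟩
    exact (h2 hm).2 (by rw [← h1 hm, h0 hsm]))
  rw [uIcc_of_le hαβ.le] at hc
  intro s hs
  rw [hc s hs, hc α ⟨le_rfl, hαβ.le⟩]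

end RiemMetricOn

/-! ### Zero sets whose gaps have a minimal length -/

section ZeroSet

/-- A point where a continuous function does not vanish lies in a gap of its zero set. -/
theorem ContinuousOn.exists_gap {u : ℝ → ℝ} {a b s : ℝ} (hu : ContinuousOn u (Icc a b))
    (ha : u a = 0) (hb : u b = 0) (hs : s ∈ Icc a b) (hus : u s ≠ 0) :
    ∃ c d, a ≤ c ∧ c < s ∧ s < d ∧ d ≤ b ∧ u c = 0 ∧ u d = 0 ∧ ∀ t ∈ Ioo c d, u t ≠ 0 := by
  have h1 : IsCompact (Icc a s ∩ u ⁻¹' {0}) :=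
    isCompact_Icc.of_isClosed_subset
      ((hu.mono (Icc_subset_Icc_right hs.2)).preimage_isClosed_of_isClosed isClosed_Icc
        isClosed_singleton) inter_subset_left
  have h2 : IsCompact (Icc s b ∩ u ⁻¹' {0}) :=
    isCompact_Icc.of_isClosed_subset
      ((hu.mono (Icc_subset_Icc_left hs.1)).preimage_isClosed_of_isClosed isClosed_Icc
        isClosed_singleton) inter_subset_left
  obtain ⟨c, ⟨hcm, hc0⟩, hc⟩ := h1.exists_isGreatest ⟨a, ⟨le_rfl, hs.1⟩, ha⟩
  obtain ⟨d, ⟨hdm, hd0⟩, hd⟩ := h2.exists_isLeast ⟨b, ⟨hs.2, le_rfl⟩, hb⟩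
  have hc0' : u c = 0 := hc0
  have hd0' : u d = 0 := hd0
  refine ⟨c, d, hcm.1, lt_of_le_of_ne hcm.2 ?_, lt_of_le_of_ne hdm.1 ?_, hdm.2, hc0', hd0', ?_⟩
  · rintro rfl
    exact hus hc0'
  · rintro rfl
    exact hus hd0'
  · intro t ht h0
    rcases le_total t s with hts | hts
    · exact ht.1.not_ge (hc ⟨⟨hcm.1.trans ht.1.le, hts⟩, h0⟩)
    · exact ht.2.not_ge (hd ⟨⟨hts, ht.2.le.trans hdm.2⟩, h0⟩)

/-- If the gaps of the zero set of a continuous function are longer than `η`, this zero set is a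
finite disjoint union of closed intervals. -/
theorem exists_finset_zeroSet_eq {u : ℝ → ℝ} {η : ℝ} (n : ℕ) :
    ∀ a b : ℝ, a ≤ b → b - a < n * η → ContinuousOn u (Icc a b) → u a = 0 → u b = 0 →
      (∀ c d, a ≤ c → c < d → d ≤ b → u c = 0 → u d = 0 → (∀ t ∈ Ioo c d, u t ≠ 0) →
        η ≤ d - c) →
      ∃ F : Finset (ℝ × ℝ), (∀ p ∈ F, p.1 ≤ p.2) ∧
        (∀ p ∈ F, ∀ r ∈ F, p ≠ r → Disjoint (Icc p.1 p.2) (Icc r.1 r.2)) ∧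
        {s ∈ Icc a b | u s = 0} = ⋃ p ∈ F, Icc p.1 p.2 := by
  induction n with
  | zero =>
    intro a b hab h
    norm_num at h
    linarith
  | succ n ih =>
    intro a b hab hlen hu ha hb hgap
    by_cases hz : ∀ s ∈ Icc a b, u s = 0
    · refine ⟨{(a, b)}, by simpa using hab, ?_, ?_⟩
      · intro p hp r hr hpr
        rw [Finset.mem_singleton] at hp hr
        exact absurd (hp.trans hr.symm) hpr
      · ext s
        simpa using fun h1 h2 => hz s ⟨h1, h2⟩
    · push Not at hz
      obtain ⟨s, hs, hus⟩ := hz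
      obtain ⟨c, d, hac, hcs, hsd, hdb, hc, hd, hcd⟩ := hu.exists_gap ha hb hs hus
      have hlong := hgap c d hac (hcs.trans hsd) hdb hc hd hcd
      push_cast at hlen
      -- Removing a gap of length at least `η` leaves two pieces, each shorter than `[a,b]` by at
      -- least `η`, so the induction hypothesis applies to both.
      obtain ⟨F₁, h₁, h₁', h₁''⟩ := ih a c hac (by linarith)
        (hu.mono (Icc_subset_Icc_right (by linarith))) ha hc
        fun c' d' h1 h2 h3 => hgap c' d' h1 h2 (by linarith)
      obtain ⟨F₂, h₂, h₂', h₂''⟩ := ih d b hdb (by linarith)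
        (hu.mono (Icc_subset_Icc_left (by linarith))) hd hb
        fun c' d' h1 h2 h3 => hgap c' d' (by linarith) h2 h3
      have hF₁ : ∀ p ∈ F₁, Icc p.1 p.2 ⊆ Icc a c := fun p hp t ht =>
        ((Set.ext_iff.1 h₁'' t).2 (mem_iUnion₂.2 ⟨p, hp, ht⟩)).1
      have hF₂ : ∀ p ∈ F₂, Icc p.1 p.2 ⊆ Icc d b := fun p hp t ht =>
        ((Set.ext_iff.1 h₂'' t).2 (mem_iUnion₂.2 ⟨p, hp, ht⟩)).1
      have hdisj : Disjoint (Icc a c) (Icc d b) :=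
        disjoint_left.2 fun t h1 h2 => by linarith [h1.2, h2.1]
      refine ⟨F₁ ∪ F₂, ?_, ?_, ?_⟩
      · intro p hp
        exact (Finset.mem_union.1 hp).elim (h₁ p) (h₂ p)
      · intro p hp r hr hpr
        rcases Finset.mem_union.1 hp with hp | hp <;> rcases Finset.mem_union.1 hr with hr | hr
        · exact h₁' p hp r hr hpr
        · exact hdisj.mono (hF₁ p hp) (hF₂ r hr)
        · exact hdisj.symm.mono (hF₂ p hp) (hF₁ r hr)
        · exact h₂' p hp r hr hpr
      · rw [Finset.set_biUnion_union, ← h₁'', ← h₂'']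
        ext t
        constructor
        · rintro ⟨ht, h0⟩
          rcases le_or_gt t c with htc | htc
          · exact Or.inl ⟨⟨ht.1, htc⟩, h0⟩
          · rcases lt_or_ge t d with htd | htd
            · exact absurd h0 (hcd t ⟨htc, htd⟩)
            · exact Or.inr ⟨⟨htd, ht.2⟩, h0⟩
        · rintro (⟨ht, h0⟩ | ⟨ht, h0⟩)
          · exact ⟨⟨ht.1, by linarith [ht.2]⟩, h0⟩
          · exact ⟨⟨by linarith [ht.1], ht.2⟩, h0⟩

end ZeroSet

/-! ### Boundary terms, orthogonality and gluing of geodesic arcs -/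

/-- A linear form that is nonnegative on an open half-space vanishes on the boundary of this
half-space. -/
theorem eq_zero_of_nonneg_on_halfSpace {E : Type*} [AddCommGroup E] [Module ℝ E]
    (l L : E →ₗ[ℝ] ℝ) {n : E} (hn : 0 < l n) (h : ∀ w, 0 < l w → 0 ≤ L w) {u : E} (hu : l u = 0) :
    L u = 0 := by
  by_contra hne
  -- Moving along `u` stays in the half-space; the coefficient is chosen so that `L` takes the value
  -- `-1`.
  have h1 := h (n + (-(L n + 1) / L u) • u) (by simpa [hu] using hn)
  rw [map_add, map_smul, smul_eq_mul, div_mul_cancel₀ _ hne] at h1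
  linarith

namespace RiemMetricOn

variable {N : ℕ} {U : Set (Euc N)} {g : RiemMetricOn U} {φ : Euc N → ℝ} {x : ℝ → Euc N}
  {a b α β : ℝ}

/-- The first variation of the energy of a geodesic. -/
theorem IsGeodesicOn.integral_firstVariation (h : g.IsGeodesicOn x a b) (hU : IsOpen U)
    {V : ℝ → Euc N} (hV : ContDiff ℝ 1 V)
    (hint : IntervalIntegrable (g.firstVariation x V) volume a b) :
    ∫ s in a..b, g.firstVariation x V s =
      g.toFun (x b) (derivWithin x (Icc a b) b) (V b) -
        g.toFun (x a) (derivWithin x (Icc a b) a) (V a) := by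
  have hd : ∀ s ∈ Icc a b, HasDerivWithinAt
      (fun s => g.toFun (x s) (derivWithin x (Icc a b) s) (V s))
      (g.force (x s) (derivWithin x (Icc a b) s) (V s)
        + g.toFun (x s) (derivWithin x (Icc a b) s) (deriv V s)) (Icc a b) s := fun s hs =>
    (h.hasDerivWithinAt_momentum hU hs).clm_apply
      ((hV.differentiable (by norm_num)) s).hasDerivAt.hasDerivWithinAt
  refine intervalIntegral.integral_eq_sub_of_hasDerivAt_of_le h.1.le
    (fun s hs => (hd s hs).continuousWithinAt) (fun s hs => ?_) hint
  have hn : Icc a b ∈ 𝓝 s := Icc_mem_nhds hs.1 hs.2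
  refine ((hd s (Ioo_subset_Icc_self hs)).hasDerivAt hn).congr_deriv ?_
  rw [firstVariation, derivWithin_of_mem_nhds hn]
  ring

/-- A field of the cone with prescribed strictly outward value at one contact point, concentrated
near this point. -/
theorem exists_mem_outwardCone (hU : IsOpen U) (hφ : ContDiffOn ℝ 2 φ U)
    (hxc : ContinuousOn x (Icc 0 1)) (hxU : ∀ s ∈ Icc (0 : ℝ) 1, x s ∈ U) {t₀ ρ : ℝ}
    (ht₀ : t₀ ∈ Icc (0 : ℝ) 1) (hρ : 0 < ρ) {w : Euc N} (hw : 0 < fderiv ℝ φ (x t₀) w) :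
    ∃ V ∈ outwardCone g φ x, ContDiff ℝ 1 V ∧ V t₀ = w ∧ ∀ s, ρ ≤ |s - t₀| → V s = 0 := by
  have hc : ContinuousOn (fun s => fderiv ℝ φ (x s) w) (Icc 0 1) :=
    ((hφ.continuousOn_fderiv_of_isOpen hU (by norm_num)).comp hxc hxU).clm_apply continuousOn_const
  have hev : ∀ᶠ s in 𝓝[Icc 0 1] t₀, 0 < fderiv ℝ φ (x s) w := (hc t₀ ht₀).eventually_const_lt hw
  obtain ⟨ε, hε, hball⟩ := Metric.mem_nhdsWithin_iff.1 hev
  have hr : 0 < min ε ρ := lt_min hε hρ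
  -- The radius is at most `ε`, so that `w` still points outwards at each contact met by the
  -- support, and at most `ρ`, for the required localization.
  let ψ : ContDiffBump t₀ := ⟨min ε ρ / 2, min ε ρ, by linarith, by linarith⟩
  have hsm : ContDiff ℝ 1 (fun s => ψ s • w) := ψ.contDiff.smul contDiff_const
  refine ⟨fun s => ψ s • w, ⟨IsH1.of_contDiff hsm, fun s hs _ => ?_⟩, hsm, ?_, ?_⟩
  · rw [g.toFun_grad_right φ (hxU s hs), map_smul, smul_eq_mul]
    by_cases hsb : s ∈ Metric.ball t₀ ε
    · exact mul_nonneg ψ.nonneg (hball ⟨hsb, hs⟩ : 0 < fderiv ℝ φ (x s) w).le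
    · rw [ψ.zero_of_le_dist ((min_le_left _ _).trans (not_lt.1 hsb)), zero_mul]
  · have : ψ t₀ = 1 := ψ.one_of_mem_closedBall (Metric.mem_closedBall_self (by
      change 0 ≤ min ε ρ / 2
      linarith))
    simp [this]
  · intro s hs
    have : ψ s = 0 := ψ.zero_of_le_dist ((min_le_right _ _).trans (by rwa [Real.dist_eq]))
    simp [this]

/-- A variationally critical geodesic is orthogonal to `∂Ω` at its endpoints. -/
theorem IsGeodesicOn.orthogonalEnds (h : g.IsGeodesicOn x a b) (hU : IsOpen U)
    (hφ : ContDiffOn ℝ 2 φ U) (hφ' : ∀ q ∈ boundaryOf U φ, g.grad φ q ≠ 0) (hx : IsH1 0 1 x)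
    (hxU : ∀ s ∈ Icc (0 : ℝ) 1, x s ∈ U) (ha : 0 ≤ a) (hb : b ≤ 1)
    (hcrit : IsVarCriticalPortion g φ x a b) (hxa : x a ∈ boundaryOf U φ)
    (hxb : x b ∈ boundaryOf U φ) : OrthogonalEnds g φ x a b := by
  have hab := h.1
  have hxc : ContinuousOn x (Icc 0 1) := by
    have := hx.1.continuousOn
    rwa [uIcc_of_le zero_le_one] at this
  have hxab : ∀ s ∈ Icc a b, x s ∈ U := fun s hs => hxU s (Icc_subset_Icc ha hb hs)
  have hvar : ∀ V ∈ outwardCone g φ x, ContDiff ℝ 1 V →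
      0 ≤ g.toFun (x b) (derivWithin x (Icc a b) b) (V b) -
        g.toFun (x a) (derivWithin x (Icc a b) a) (V a) := by
    intro V hV hV1
    rw [← h.integral_firstVariation hU hV1
      ((intervalIntegrable_iff_integrableOn_Icc_of_le hab.le).2
        ((integrableOn_firstVariation hU hx zero_le_one hxU hV.1).mono_set
          (Icc_subset_Icc ha hb)))]
    exact firstVariation_nonneg hU hab.le hxab hcrit hV
  have hpos : ∀ q ∈ boundaryOf U φ, 0 < fderiv ℝ φ q (g.grad φ q) := fun q hq => by
    rw [← g.toFun_grad φ hq.1]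
    exact g.pos q hq.1 _ (hφ' q hq)
  constructor
  · intro u hu
    have := eq_zero_of_nonneg_on_halfSpace (fderiv ℝ φ (x a) : Euc N →ₗ[ℝ] ℝ)
      (-(g.toFun (x a) (derivWithin x (Icc a b) a)) : Euc N →L[ℝ] ℝ)
      (hpos _ hxa) (fun w hw => by
        -- With `ρ = b - a` the field vanishes at the other endpoint, and one boundary term
        -- survives.
        obtain ⟨V, hV, hV1, hVa, hVb⟩ := exists_mem_outwardCone (g := g) hU hφ hxc hxU
          (t₀ := a) (ρ := b - a) ⟨ha, hab.le.trans hb⟩ (sub_pos.2 hab) hw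
        have h1 := hvar V hV hV1
        rw [hVa, hVb b (le_abs_self _), map_zero, zero_sub] at h1
        exact h1) hu
    simpa using this
  · intro u hu
    exact eq_zero_of_nonneg_on_halfSpace (fderiv ℝ φ (x b) : Euc N →ₗ[ℝ] ℝ)
      (g.toFun (x b) (derivWithin x (Icc a b) b) : Euc N →ₗ[ℝ] ℝ)
      (hpos _ hxb) (fun w hw => by
        obtain ⟨V, hV, hV1, hVb, hVa⟩ := exists_mem_outwardCone (g := g) hU hφ hxc hxU
          (t₀ := b) (ρ := b - a) ⟨ha.trans hab.le, hb⟩ (sub_pos.2 hab) hw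
        have h1 := hvar V hV hV1
        rw [hVb, hVa a (by rw [abs_sub_comm]; exact le_abs_self _), map_zero, sub_zero] at h1
        exact h1) hu

/-- A `C¹` curve which is piecewise a geodesic is a geodesic. -/
theorem isGeodesicOn_of_contDiffOn_one (hU : IsOpen U) (hαβ : α < β)
    (hxU : ∀ s ∈ Icc α β, x s ∈ U) (hx : ContDiffOn ℝ 1 x (Icc α β)) (T : Finset ℝ)
    (hT : ∀ c d, α ≤ c → c < d → d ≤ β → (∀ t ∈ T, t ∉ Ioo c d) → g.IsGeodesicOn x c d) :
    g.IsGeodesicOn x α β := by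
  set v := derivWithin x (Icc α β) with hv
  have hxd : ∀ s ∈ Icc α β, HasDerivWithinAt x (v s) (Icc α β) s := fun s hs =>
    ((hx.differentiableOn (by norm_num)) s hs).hasDerivWithinAt
  have hvc : ContinuousOn v (Icc α β) :=
    hx.continuousOn_derivWithin (uniqueDiffOn_Icc hαβ) le_rfl
  have hkc : ContinuousOn (fun s => -g.christoffel (x s) (v s) (v s)) (Icc α β) :=
    (g.continuousOn_christoffel_comp hU hx.continuousOn hxU hvc hvc).neg
  have hvd : ∀ s ∈ Ioo α β \ (T : Set ℝ),
      HasDerivAt v (-g.christoffel (x s) (v s) (v s)) s := by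
    intro s hs
    have hnh : Ioo α β ∩ ((T.erase s : Finset ℝ) : Set ℝ)ᶜ ∈ 𝓝 s :=
      Filter.inter_mem (Ioo_mem_nhds hs.1.1 hs.1.2)
        ((Finset.isClosed _).isOpen_compl.mem_nhds (by simp))
    obtain ⟨ε, hε, hball⟩ := Metric.nhds_basis_closedBall.mem_iff.1 hnh
    rw [Real.closedBall_eq_Icc] at hball
    have hle : s - ε ≤ s + ε := by linarith
    have hgeo := hT (s - ε) (s + ε) (hball ⟨le_rfl, hle⟩).1.1.le (by linarith)
      (hball ⟨hle, le_rfl⟩).1.2.le fun t ht htm => by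
        have h1 := (hball (Ioo_subset_Icc_self htm)).2
        rcases eq_or_ne t s with rfl | hne
        · exact hs.2 ht
        · exact h1 (Finset.mem_coe.2 (Finset.mem_erase.2 ⟨hne, ht⟩))
    have heq : ∀ t ∈ Ioo (s - ε) (s + ε), derivWithin x (Icc (s - ε) (s + ε)) t = v t := by
      intro t ht
      have h1 := (hball (Ioo_subset_Icc_self ht)).1
      rw [hv, derivWithin_of_mem_nhds (Icc_mem_nhds ht.1 ht.2),
        derivWithin_of_mem_nhds (Icc_mem_nhds h1.1 h1.2)]
    have hsm : s ∈ Ioo (s - ε) (s + ε) := ⟨by linarith, by linarith⟩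
    have h2 := (hgeo.hasDerivWithinAt_velocity (Ioo_subset_Icc_self hsm)).hasDerivAt
      (Icc_mem_nhds hsm.1 hsm.2)
    rw [heq s hsm] at h2
    exact h2.congr_of_eventuallyEq
      (Filter.eventually_of_mem (Ioo_mem_nhds hsm.1 hsm.2) fun t ht => (heq t ht).symm)
  refine g.isGeodesicOn_of_hasDerivWithinAt hU hαβ hxU hxd fun s hs => ?_
  refine ((hkc.hasDerivWithinAt_integral_Icc hαβ.le hs).const_add (v α)).congr_of_mem
    (fun t ht => ?_) hs
  have hsub : Icc α t ⊆ Icc α β := Icc_subset_Icc_right ht.2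
  -- The velocity is continuous and satisfies the equation off the finite set `T`, so it is a
  -- primitive of the continuous right-hand side, and the equation also holds on `T`.
  rw [integral_eq_of_hasDerivAt_off_countable v _ T.countable_toSet]
  · abel
  · rw [uIcc_of_le ht.1]
    exact hvc.mono hsub
  · rw [min_eq_left ht.1, max_eq_right ht.1]
    exact fun r hr => hvd r ⟨⟨hr.1.1, hr.1.2.trans_le ht.2⟩, hr.2⟩
  · rw [intervalIntegrable_iff_integrableOn_Icc_of_le ht.1]
    exact (hkc.mono hsub).integrableOn_compact isCompact_Icc

end RiemMetricOn

/-! ### Assembly of the conclusions -/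

theorem proposition4p2 {N : ℕ} (hN : 2 ≤ N)
    (U : Set (EuclideanSpace ℝ (Fin N))) (hU : IsOpen U) (g : RiemMetricOn U)
    (φ : EuclideanSpace ℝ (Fin N) → ℝ) (hφ : ContDiffOn ℝ 2 φ U)
    (hφ' : ∀ q ∈ boundaryOf U φ, g.grad φ q ≠ 0)
    (hconc : StronglyConcave g φ)
    (δ₀ : ℝ) (hδ₀ : IsConcavityWidth g φ δ₀) (M₀ : ℝ)
    (x : ℝ → EuclideanSpace ℝ (Fin N)) (hx : x ∈ pathSpace g φ δ₀ M₀)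
    (a b : ℝ) (hab : (a, b) ∈ intervals0 U φ x)
    (hcrit : IsVarCriticalPortion g φ x a b) :
    -- portions lying in `Ω`, except possibly for their endpoints, are geodesics
    (∀ α β : ℝ, a ≤ α → α < β → β ≤ b → (∀ s ∈ Ioo α β, x s ∈ domainOf U φ) →
      g.IsGeodesicOn x α β) ∧
    -- the contact set is a finite disjoint union of closed intervals, possibly degenerate
    (∃ F : Finset (ℝ × ℝ), (∀ p ∈ F, p.1 ≤ p.2) ∧
      (∀ p ∈ F, ∀ r ∈ F, p ≠ r → Disjoint (Icc p.1 p.2) (Icc r.1 r.2)) ∧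
      contactSet U φ x a b = ⋃ p ∈ F, Icc p.1 p.2) ∧
    -- `x` is constant on each connected component of the contact set
    (∀ s ∈ contactSet U φ x a b, ∀ t ∈ connectedComponentIn (contactSet U φ x a b) s,
      x t = x s) ∧
    -- `x` is piecewise `C²` on `[a,b]`, with break points on `∂Ω` only
    (∃ T : Finset ℝ, (∀ t ∈ T, t ∈ contactSet U φ x a b) ∧
      ∀ α β : ℝ, a ≤ α → α < β → β ≤ b → (∀ t ∈ T, t ∉ Ioo α β) →
        ContDiffOn ℝ 2 x (Icc α β)) ∧
    -- each `C²` portion is a geodesic (in the closure of `Ω`)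
    (∀ α β : ℝ, a ≤ α → α < β → β ≤ b → ContDiffOn ℝ 2 x (Icc α β) →
      g.IsGeodesicOn x α β ∧ ∀ s ∈ Icc α β, x s ∈ closureOf U φ) ∧
    -- `inf φ(x([a,b])) < -δ₀`
    sInf ((fun s => φ (x s)) '' Icc a b) < -δ₀ ∧
    -- a `C¹` portion is an orthogonal geodesic chord when there is no WOGC
    ((¬ ∃ (γ : ℝ → EuclideanSpace ℝ (Fin N)) (c d : ℝ), IsWOGC g φ γ c d) →
      ContDiffOn ℝ 1 x (Icc a b) → IsOGC g φ x a b) := by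
  obtain ⟨⟨hxH, hxUδ, -, -⟩, -⟩ := hx
  obtain ⟨ha, hab', hb, hcl, hxa, hxb⟩ := hab
  dsimp only at ha hab' hb hcl hxa hxb
  have hxU : ∀ s ∈ Icc (0 : ℝ) 1, x s ∈ U := fun s hs => (hxUδ s hs).1
  have hsub : Icc a b ⊆ Icc (0 : ℝ) 1 := Icc_subset_Icc ha hb
  have hxc : ContinuousOn x (Icc 0 1) := by
    have := hxH.1.continuousOn
    rwa [uIcc_of_le zero_le_one] at this
  have hu : ContinuousOn (fun s => φ (x s)) (Icc a b) :=
    hφ.continuousOn.comp (hxc.mono hsub) fun s hs => hxU s (hsub hs)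
  have hu0 : ∀ s ∈ Icc a b, φ (x s) ≤ 0 := fun s hs =>
    (hcl s hs).elim (fun h => h.2.le) fun h => h.2.le
  have hdom : ∀ s ∈ Icc a b, φ (x s) ≠ 0 → x s ∈ domainOf U φ := fun s hs h =>
    ⟨hxU s (hsub hs), lt_of_le_of_ne (hu0 s hs) h⟩
  have hcontact : contactSet U φ x a b = {s ∈ Icc a b | φ (x s) = 0} :=
    Set.ext fun s => ⟨fun h => ⟨h.1, h.2.2⟩, fun h => ⟨h.1, hxU s (hsub h.1), h.2⟩⟩
  have hlt : a < b := by
    obtain ⟨s, hs, t, ht, hst⟩ := hcrit.1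
    by_contra hge
    have hs' : s = t := by linarith [hs.1, hs.2, ht.1, ht.2]
    exact hst (congrArg x hs')
  have h1 : ∀ α β : ℝ, a ≤ α → α < β → β ≤ b → (∀ s ∈ Ioo α β, x s ∈ domainOf U φ) →
      g.IsGeodesicOn x α β := fun α β hα hαβ hβ hΩ =>
    RiemMetricOn.isGeodesicOn_of_mem_domain hU hxH hxU ha hb hab' hcrit hα hαβ hβ hΩ
  have hconst : ∀ α β : ℝ, a ≤ α → α < β → β ≤ b → (∀ s ∈ Icc α β, x s ∈ boundaryOf U φ) →
      ∀ s ∈ Icc α β, x s = x α := fun α β hα hαβ hβ hΩ =>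
    RiemMetricOn.eq_of_forall_mem_boundary hU hφ hconc hxH hxU ha hb hab' hcrit hα hαβ hβ hΩ
  have hgap : ∀ c d, a ≤ c → c < d → d ≤ b → φ (x c) = 0 → φ (x d) = 0 →
      (∀ t ∈ Ioo c d, φ (x t) ≠ 0) → ∃ s ∈ Ioo c d, φ (x s) < -δ₀ := by
    intro c d hc hcd hd hc0 hd0 h
    have hΩ : ∀ s ∈ Ioo c d, x s ∈ domainOf U φ := fun s hs =>
      hdom s ⟨hc.trans hs.1.le, hs.2.le.trans hd⟩ (h s hs)
    exact (h1 c d hc hcd hd hΩ).exists_lt_neg_width hU hφ hδ₀ hc0 hd0 fun s hs => (hΩ s hs).2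
  have h2 : ∃ F : Finset (ℝ × ℝ), (∀ p ∈ F, p.1 ≤ p.2) ∧
      (∀ p ∈ F, ∀ r ∈ F, p ≠ r → Disjoint (Icc p.1 p.2) (Icc r.1 r.2)) ∧
      contactSet U φ x a b = ⋃ p ∈ F, Icc p.1 p.2 := by
    -- In time less than `η`, `φ ∘ x` varies by less than `δ₀`, whereas each gap descends from `0`
    -- to below `-δ₀`; hence gaps have length at least `η`.
    obtain ⟨η, hη, hunif⟩ := Metric.uniformContinuousOn_iff.1
      (isCompact_Icc.uniformContinuousOn_of_continuous hu) δ₀ hδ₀.1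
    obtain ⟨n, hn⟩ := exists_nat_gt ((b - a) / η)
    rw [hcontact]
    refine exists_finset_zeroSet_eq (η := η) n a b hab' ((div_lt_iff₀ hη).1 hn) hu hxa.2 hxb.2 ?_
    intro c d hc hcd hd hc0 hd0 h
    obtain ⟨s, hs, hsδ⟩ := hgap c d hc hcd hd hc0 hd0 h
    by_contra hshort
    have hd1 : dist c s < η := by
      rw [dist_comm, Real.dist_eq, abs_of_pos (sub_pos.2 hs.1)]
      linarith [hs.2]
    have hd2 := hunif c ⟨hc, hcd.le.trans hd⟩ s ⟨hc.trans hs.1.le, hs.2.le.trans hd⟩ hd1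
    rw [hc0, Real.dist_eq, zero_sub, abs_neg] at hd2
    linarith [neg_abs_le (φ (x s))]
  have h3 : ∀ s ∈ contactSet U φ x a b,
      ∀ t ∈ connectedComponentIn (contactSet U φ x a b) s, x t = x s := by
    intro s hs t ht
    have hss := mem_connectedComponentIn hs
    have hord := (isPreconnected_connectedComponentIn
      (F := contactSet U φ x a b) (x := s)).ordConnected
    have key : ∀ p q : ℝ, p ∈ connectedComponentIn (contactSet U φ x a b) s →
        q ∈ connectedComponentIn (contactSet U φ x a b) s → p < q → x q = x p := by
      intro p q hp hq hpq
      have hIcc : Icc p q ⊆ contactSet U φ x a b :=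
        (hord.out hp hq).trans (connectedComponentIn_subset _ _)
      exact hconst p q (hIcc ⟨le_rfl, hpq.le⟩).1.1 hpq (hIcc ⟨hpq.le, le_rfl⟩).1.2
        (fun r hr => (hIcc hr).2) q ⟨hpq.le, le_rfl⟩
    rcases lt_trichotomy s t with h | h | h
    · exact key s t hss ht h
    · rw [h]
    · exact (key t s ht hss h).symm
  have h4 : ∃ T : Finset ℝ, (∀ t ∈ T, t ∈ contactSet U φ x a b) ∧
      ∀ α β : ℝ, a ≤ α → α < β → β ≤ b → (∀ t ∈ T, t ∉ Ioo α β) → g.IsGeodesicOn x α β := by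
    obtain ⟨F, hF1, -, hF3⟩ := h2
    -- The break points are the ends of the contact intervals. An open interval avoiding them either
    -- misses the contact set or lies in a single contact interval, where `x` is constant.
    refine ⟨F.image Prod.fst ∪ F.image Prod.snd, fun t ht => ?_, fun α β hα hαβ hβ hT => ?_⟩
    · rw [hF3]
      rcases Finset.mem_union.1 ht with ht | ht <;> obtain ⟨p, hp, rfl⟩ := Finset.mem_image.1 ht
      · exact mem_iUnion₂.2 ⟨p, hp, le_rfl, hF1 p hp⟩
      · exact mem_iUnion₂.2 ⟨p, hp, hF1 p hp, le_rfl⟩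
    · by_cases hΩ : ∀ s ∈ Ioo α β, φ (x s) ≠ 0
      · exact h1 α β hα hαβ hβ fun s hs => hdom s ⟨hα.trans hs.1.le, hs.2.le.trans hβ⟩ (hΩ s hs)
      · push Not at hΩ
        obtain ⟨s, hs, hs0⟩ := hΩ
        have hsK : s ∈ contactSet U φ x a b := by
          rw [hcontact]
          exact ⟨⟨hα.trans hs.1.le, hs.2.le.trans hβ⟩, hs0⟩
        rw [hF3] at hsK
        obtain ⟨p, hp, hsp⟩ := mem_iUnion₂.1 hsK
        have hp1 : p.1 ≤ α := by
          by_contra hlt'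
          exact hT p.1 (Finset.mem_union_left _ (Finset.mem_image_of_mem _ hp))
            ⟨not_le.1 hlt', hsp.1.trans_lt hs.2⟩
        have hp2 : β ≤ p.2 := by
          by_contra hlt'
          exact hT p.2 (Finset.mem_union_right _ (Finset.mem_image_of_mem _ hp))
            ⟨hs.1.trans_le hsp.2, not_le.1 hlt'⟩
        have hK : ∀ r ∈ Icc α β, x r ∈ boundaryOf U φ := fun r hr =>
          ((Set.ext_iff.1 hF3 r).2
            (mem_iUnion₂.2 ⟨p, hp, hp1.trans hr.1, hr.2.trans hp2⟩)).2
        exact g.isGeodesicOn_of_eqOn_const hαβ (hK α ⟨le_rfl, hαβ.le⟩).1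
          (hconst α β hα hαβ hβ hK)
  obtain ⟨T, hTK, hT⟩ := h4
  have hC1 : ∀ α β : ℝ, a ≤ α → α < β → β ≤ b → ContDiffOn ℝ 1 x (Icc α β) →
      g.IsGeodesicOn x α β := fun α β hα hαβ hβ hx1 =>
    RiemMetricOn.isGeodesicOn_of_contDiffOn_one hU hαβ
      (fun s hs => hxU s (hsub (Icc_subset_Icc hα hβ hs))) hx1 T
      fun c d hc hcd hd => hT c d (hα.trans hc) hcd (hd.trans hβ)
  refine ⟨h1, h2, h3, ⟨T, hTK, fun α β hα hαβ hβ h => (hT α β hα hαβ hβ h).2.2.1⟩,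
    fun α β hα hαβ hβ hx2 => ⟨hC1 α β hα hαβ hβ (hx2.of_le (by norm_num)),
      fun s hs => hcl s (Icc_subset_Icc hα hβ hs)⟩, ?_, ?_⟩
  -- If all of `[a,b]` were in contact, `x` would be constant there; so a gap exists, and it dips
  -- below `-δ₀`.
  · have hne : ∃ s ∈ Icc a b, φ (x s) ≠ 0 := by
      by_contra hall
      push Not at hall
      obtain ⟨s, hs, t, ht, hst⟩ := hcrit.1
      have hcon := hconst a b le_rfl hlt le_rfl fun s hs => ⟨hxU s (hsub hs), hall s hs⟩
      exact hst ((hcon s hs).trans (hcon t ht).symm)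
    obtain ⟨s, hs, hs0⟩ := hne
    obtain ⟨c, d, hac, hcs, hsd, hdb, hc, hd, hcd⟩ := hu.exists_gap hxa.2 hxb.2 hs hs0
    obtain ⟨r, hr, hrδ⟩ := hgap c d hac (hcs.trans hsd) hdb hc hd hcd
    exact (csInf_le (isCompact_Icc.bddBelow_image hu)
      (mem_image_of_mem _ ⟨hac.trans hr.1.le, hr.2.le.trans hdb⟩)).trans_lt hrδ
  · intro hW hx1
    have hgeo := hC1 a b le_rfl hlt le_rfl hx1
    have horth := hgeo.orthogonalEnds hU hφ hφ' hxH hxU ha hb hcrit hxa hxb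
    refine ⟨hgeo, fun s hs => hdom s (Ioo_subset_Icc_self hs) fun h0 => ?_, hxa, hxb, horth⟩
    exact hW ⟨x, a, b, hgeo, hcrit.1, hcl, hxa, hxb,
      ⟨s, hs, hxU s (hsub (Ioo_subset_Icc_self hs)), h0⟩, horth⟩
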